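/- Let $\mathfrak{A}$ be a unital C$^*$-algebra, let $\mathfrak{A}^{-1}$ be its group of invertible elements with the norm topology, and let $\mathfrak{A}^{-1}_0$ be the connected component of the identity in $\mathfrak{A}^{-1}$. For $T \in \mathfrak{A}$ let $\sigma(T)$ denote the spectrum of $T$ in $\mathfrak{A}$, and let $\mathcal{S}(T) = \{VTV^{-1} : V \in \mathfrak{A}^{-1}\}$ denote the similarity orbit of $T$, with norm closure $\overline{\mathcal{S}(T)}$. A projection is an element $P=P^*=P^2$; projections $P,Q$ are Murray–von Neumann equivalent if $P = V^*V$ and $Q = VV^*$ for some $V\in\mathfrak{A}$; a projection $P$ is properly infinite if there are projections $E,F \le P$ with $EF = 0$ that are both Murray–von Neumann equivalent to $P$. Suppose that (a) $\mathfrak{A}$ has property weak (FN): every normal $T \in \mathfrak{A}$ such that $\lambda I - T \in \mathfrak{A}^{-1}_0$ for all $\lambda \in \mathbb{C}\setminus\sigma(T)$ is a norm limit of normal elements of $\mathfrak{A}$ with finite spectrum; (b) every non-zero projection in $\mathfrak{A}$ is properly infinite; (c) any two non-zero projections in $\mathfrak{A}$ are Murray–von Neumann equivalent. Let $N, M \in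 \mathfrak{A}$ be normal elements such that $\lambda I - M \in \mathfrak{A}^{-1}_0$ for all $\lambda \in \mathbb{C}\setminus\sigma(M)$. Then $N \in \overline{\mathcal{S}(M)}$ if and only if all of the following hold: 1. $\sigma(M) \subseteq \sigma(N)$; 2. each connected component of $\sigma(N)$ intersects $\sigma(M)$; 3. $\lambda I - N \in \mathfrak{A}^{-1}_0$ for all $\lambda \in \mathbb{C}\setminus\sigma(N)$; 4. if $\lambda \in \sigma(N)$ is not isolated in $\sigma(N)$, then the connected component of $\lambda$ in $\sigma(N)$ contains some non-isolated point of $\sigma(M)$. -/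

import Mathlib

/-- The similarity orbit `{V a V⁻¹ : V invertible}` of an element `a`. -/
def similarityOrbit {A : Type*} [CStarAlgebra A] (a : A) : Set A :=
  {b | ∃ V : Aˣ, b = (V : A) * a * ((V⁻¹ : Aˣ) : A)}

/-- The connected component of the identity in the set of invertible elements of `A`,
with the norm topology. -/
def invertibleComponentOfOne (A : Type*) [CStarAlgebra A] : Set A :=
  connectedComponentIn {a : A | IsUnit a} 1

/-- `lam • 1 - a` lies in the identity component of the invertible elements, for every
complex number `lam` outside the spectrum of `a`. -/
def ResolventInIdentityComponent {A : Type*} [CStarAlgebra A] (a : A) : Prop :=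
  ∀ lam : ℂ, lam ∉ spectrum ℂ a → algebraMap ℂ A lam - a ∈ invertibleComponentOfOne A

/-- Property weak (FN): every normal `N` with `lam • 1 - N` in the identity component of the
invertible elements for all `lam` outside the spectrum of `N` is a norm limit of normal elements
with finite spectrum. -/
def WeakFN (A : Type*) [CStarAlgebra A] : Prop :=
  ∀ N : A, IsStarNormal N → ResolventInIdentityComponent N →
    N ∈ closure {B : A | IsStarNormal B ∧ (spectrum ℂ B).Finite}

/-- Murray-von Neumann equivalence of (projections) `p` and `q` in `A`. -/
def MvNEquiv {A : Type*} [CStarAlgebra A] (p q : A) : Prop :=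
  ∃ v : A, star v * v = p ∧ v * star v = q

/-- A projection `p` is properly infinite if it has two mutually orthogonal subprojections, each
of them Murray-von Neumann equivalent to `p`. Here `p * e = e` says that the projection `e` is a
subprojection of `p`. -/
def IsProperlyInfinite {A : Type*} [CStarAlgebra A] (p : A) : Prop :=
  ∃ e f : A, IsStarProjection e ∧ IsStarProjection f ∧ p * e = e ∧ p * f = f ∧ e * f = 0 ∧
    MvNEquiv p e ∧ MvNEquiv p f

/-- `x` is a non-isolated point of `S`: it belongs to `S` and is an accumulation point of `S`. -/
def IsNonIsolatedPoint (S : Set ℂ) (x : ℂ) : Prop :=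
  x ∈ S ∧ AccPt x (Filter.principal S)

/-!
The theorem characterises the normal limits `N` of the similarity orbit of a normal element `M` in
a C⋆-algebra in which non-zero projections can be split and are all equivalent.

Necessity. If `f` is smooth with compact support, the Cauchy-Pompeiu formula
`integral_wirtingerBar_mul_inv` writes `f z` as `-1/π` times the integral of
`∂f/∂w̄ (w) (w - z)⁻¹`. Replacing `z` by `T` gives an element `cauchyTransform f T` that makes sense
whenever the spectrum of `T` avoids the support of `∂f/∂w̄`. It commutes with similarities, is
continuous in `T`, and for normal `T` it is a multiple of `cfc f T`. So if `f` is holomorphic near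
the spectrum of `N` and vanishes on the spectrum of `M`, it vanishes on the spectrum of `N`
(`eqOn_zero_spectrum_of_mem_closure`). Taking for `f` a polynomial on a clopen part of the spectrum
of `N` and zero on the rest shows that a clopen part meeting the spectrum of `M` in a finite set is
contained in it (`subset_spectrum_of_finite_inter`). As components are intersections of clopen
sets, both conditions on components follow.

Sufficiency. By weak (FN), `N` and `M` are limits of diagonal elements, that is, of finite linear
combinations of partitions of `1` into non-zero projections. Since these projections can be split
and matched at will, a limit of diagonal elements is determined up to approximate unitary
equivalence by the limit `K` of the sets of eigenvalues, and depends on `K` continuously for the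
Hausdorff distance (`IsDiagonalLimit.exists_unitary_conj_near`). It remains to enlarge
the spectrum of `M` inside the closure of the similarity orbit until it is close to that of `N`. The
basic move (`mem_closure_similarityOrbit_of_segment`) attaches to `K` any segment centred at a
non-isolated point `μ`: there are arbitrarily many distinct eigenvalues near `μ`, and a diagonal
matrix with distinct entries is similar to itself plus any strictly upper triangular `Q`. Triangular
truncation being unbounded, there are such `Q` with `Q - Qᴴ` small and `Q + Qᴴ` of norm `2`: the
Toeplitz matrix with entries `1 / (j - i)`, suitably scaled, has this property by
Hilbert's inequality. A direct sum of multiples of `Q` is then close to a hermitian matrix whose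
eigenvalues are dense in `[-1, 1]` (`exists_strictUpper_near_hermitian`). Chains of short segments
run along each component of the spectrum of `N` containing a non-isolated point of the spectrum of
`M`, and every other component is an isolated point that already belongs to the spectrum of `M`.
-/

/-! ### The Cauchy-Pompeiu formula -/

section CauchyPompeiu

/-- The Wirtinger derivative `∂f/∂z̄ = (∂f/∂x + i ∂f/∂y) / 2` of a function on the plane. -/
noncomputable def wirtingerBar (f : ℂ → ℂ) (w : ℂ) : ℂ :=
  (fderiv ℝ f w 1 + Complex.I * fderiv ℝ f w Complex.I) / 2

theorem continuous_wirtingerBar {f : ℂ → ℂ} (hf : ContDiff ℝ 1 f) :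
    Continuous (wirtingerBar f) := by
  have h := hf.continuous_fderiv one_ne_zero
  unfold wirtingerBar
  fun_prop

theorem tsupport_wirtingerBar_subset (f : ℂ → ℂ) :
    tsupport (wirtingerBar f) ⊆ tsupport f := by
  refine closure_minimal (fun w hw => ?_) (isClosed_tsupport f)
  refine tsupport_fderiv_subset ℝ (subset_tsupport _ fun h => hw ?_)
  simp [wirtingerBar, h]

theorem wirtingerBar_eq_zero_of_differentiableAt {f : ℂ → ℂ} {w : ℂ}
    (hf : DifferentiableAt ℂ f w) : wirtingerBar f w = 0 := by
  have h : fderiv ℝ f w = (fderiv ℂ f w).restrictScalars ℝ := hf.fderiv_restrictScalars ℝ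
  have h2 : fderiv ℂ f w Complex.I = Complex.I * fderiv ℂ f w 1 := by
    rw [← smul_eq_mul, ← map_smul, smul_eq_mul, mul_one]
  simp only [wirtingerBar, h, ContinuousLinearMap.coe_restrictScalars', h2]
  rw [← mul_assoc, Complex.I_mul_I]
  ring

open MeasureTheory Set in
/-- The Cauchy-Pompeiu formula for compactly supported functions: `1 / (π w)` is a fundamental
solution of `∂/∂z̄`. In polar coordinates around `z`, the integrand is the sum of a radial
derivative, which integrates to `-f z`, and an angular one, which integrates to zero. -/
theorem integral_wirtingerBar_mul_inv {f : ℂ → ℂ} (hf : ContDiff ℝ 1 f)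
    (hc : HasCompactSupport f) (z : ℂ) :
    ∫ w, wirtingerBar f w * (w - z)⁻¹ = -Real.pi * f z := by
  have hfd := hf.continuous_fderiv one_ne_zero
  set e : ℝ → ℂ := fun θ => Complex.exp (θ * Complex.I) with he
  have he_cont : Continuous e := by fun_prop
  have he_deriv : ∀ θ, HasDerivAt e (e θ * Complex.I) θ := fun θ => by
    have := ((Complex.ofRealCLM.hasDerivAt (x := θ)).mul_const Complex.I).cexp
    simpa [he] using this
  have he_norm : ∀ θ, ‖e θ‖ = 1 := fun θ => Complex.norm_exp_ofReal_mul_I θ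
  -- the support of `f` lies in the ball of radius `R` around `z`
  obtain ⟨R, hR0, hR⟩ : ∃ R : ℝ, 0 < R ∧ ∀ w, R ≤ ‖w - z‖ → w ∉ tsupport f := by
    obtain ⟨R, hR0, hR⟩ := hc.isBounded.subset_ball_lt 0 z
    refine ⟨R, hR0, fun w hw hw' => ?_⟩
    have := hR hw'
    rw [Metric.mem_ball, dist_eq_norm] at this
    linarith
  have hfd0 : ∀ w, R ≤ ‖w - z‖ → fderiv ℝ f w = 0 := fun w hw => by
    by_contra h
    exact hR w hw (tsupport_fderiv_subset ℝ (subset_tsupport _ h))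
  have hf0 : ∀ w, R ≤ ‖w - z‖ → f w = 0 := fun w hw => image_eq_zero_of_notMem_tsupport (hR w hw)
  set c : ℝ → ℝ → ℂ := fun r θ => z + r * e θ with hcdef
  have hcz : ∀ r θ, 0 ≤ r → ‖c r θ - z‖ = r := fun r θ hr => by
    simp [hcdef, he_norm, abs_of_nonneg hr]
  set H1 : ℝ × ℝ → ℂ := fun p => fderiv ℝ f (c p.1 p.2) (e p.2) with hH1
  set H2 : ℝ × ℝ → ℂ := fun p => fderiv ℝ f (c p.1 p.2) (e p.2 * Complex.I) with hH2
  have hcc : Continuous fun p : ℝ × ℝ => c p.1 p.2 := by simp only [hcdef]; fun_prop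
  have hH1c : Continuous H1 := by
    simp only [hH1]
    exact (hfd.comp hcc).clm_apply (he_cont.comp continuous_snd)
  have hH2c : Continuous H2 := by
    simp only [hH2]
    exact (hfd.comp hcc).clm_apply ((he_cont.comp continuous_snd).mul continuous_const)
  set T : Set (ℝ × ℝ) := Ioi 0 ×ˢ Ioo (-Real.pi) Real.pi with hT
  have hTm : MeasurableSet T := measurableSet_Ioi.prod measurableSet_Ioo
  have hint : ∀ H : ℝ × ℝ → ℂ, Continuous H → (∀ p, R ≤ p.1 → H p = 0) →
      IntegrableOn H T (volume.prod volume) := by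
    intro H hH h0
    have h1 : IntegrableOn H (Icc 0 R ×ˢ Icc (-Real.pi) Real.pi) (volume.prod volume) :=
      hH.continuousOn.integrableOn_compact (isCompact_Icc.prod isCompact_Icc)
    refine h1.of_forall_sdiff_eq_zero hTm ?_
    rintro ⟨r, θ⟩ ⟨⟨hr, hθ⟩, hn⟩
    refine h0 _ ?_
    by_contra hlt
    exact hn ⟨⟨le_of_lt hr, le_of_lt (not_le.1 hlt)⟩, Ioo_subset_Icc_self hθ⟩
  have hH1i := hint H1 hH1c fun p hp => by
    have : fderiv ℝ f (c p.1 p.2) = 0 := hfd0 _ (by rw [hcz _ _ (hR0.le.trans hp)]; exact hp)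
    simp [hH1, this]
  have hH2i := hint H2 hH2c fun p hp => by
    have : fderiv ℝ f (c p.1 p.2) = 0 := hfd0 _ (by rw [hcz _ _ (hR0.le.trans hp)]; exact hp)
    simp [hH2, this]
  have hcr : ∀ r θ, HasDerivAt (fun r : ℝ => f (c r θ)) (H1 (r, θ)) r := fun r θ => by
    have h1 : HasDerivAt (fun r : ℝ => c r θ) (e θ) r := by
      simpa [hcdef] using ((Complex.ofRealCLM.hasDerivAt (x := r)).mul_const (e θ)).const_add z
    exact ((hf.differentiable one_ne_zero _).hasFDerivAt).comp_hasDerivAt r h1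
  have hcθ : ∀ r θ, HasDerivAt (fun θ : ℝ => f (c r θ)) (r * H2 (r, θ)) θ := fun r θ => by
    have h1 : HasDerivAt (fun θ : ℝ => c r θ) (r * (e θ * Complex.I)) θ := by
      simpa [hcdef] using ((he_deriv θ).const_mul (r : ℂ)).const_add z
    have h2 := ((hf.differentiable one_ne_zero _).hasFDerivAt).comp_hasDerivAt θ h1
    have h3 : fderiv ℝ f (c r θ) (r * (e θ * Complex.I)) = r * H2 (r, θ) := by
      rw [← Complex.real_smul, map_smul, Complex.real_smul]
    rw [h3] at h2
    exact h2
  have hI1 : ∫ p in T, H1 p = -(2 * Real.pi) * f z := by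
    have hr : ∀ θ, ∫ r in Ioi (0:ℝ), H1 (r, θ) = - f z := fun θ => by
      have hsupp : ∀ r, R ≤ r → H1 (r, θ) = 0 := fun r hr => by
        have : fderiv ℝ f (c r θ) = 0 := hfd0 _ (by rw [hcz _ _ (hR0.le.trans hr)]; exact hr)
        simp [hH1, this]
      have h1 : ∫ r in Ioi (0:ℝ), H1 (r, θ) = 0 - f (c 0 θ) := by
        refine integral_Ioi_of_hasDerivAt_of_tendsto' (fun r _ => hcr r θ) ?_ ?_
        · have h2 : IntegrableOn (fun r => H1 (r, θ)) (Icc 0 R) :=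
            (hH1c.comp (Continuous.prodMk_left θ)).continuousOn.integrableOn_compact isCompact_Icc
          refine h2.of_forall_sdiff_eq_zero measurableSet_Ioi ?_
          rintro r ⟨hr, hn⟩
          refine hsupp r ?_
          by_contra hlt
          exact hn ⟨le_of_lt hr, le_of_lt (not_le.1 hlt)⟩
        · refine tendsto_const_nhds.congr' ?_
          filter_upwards [Filter.eventually_ge_atTop R] with r hr
          exact (hf0 _ (by rw [hcz _ _ (hR0.le.trans hr)]; exact hr)).symm
      rw [h1]
      simp [hcdef]
    rw [hT, Measure.volume_eq_prod, ← setIntegral_prod_swap, setIntegral_prod]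
    · simp only [Prod.swap_prod_mk, hr]
      rw [setIntegral_const, Measure.real, Real.volume_Ioo, ENNReal.toReal_ofReal]
      · rw [Complex.real_smul]
        push_cast
        ring
      · linarith [Real.pi_pos]
    · exact hH1i.swap
  have hI2 : ∫ p in T, H2 p = 0 := by
    rw [hT, Measure.volume_eq_prod, setIntegral_prod _ hH2i]
    refine setIntegral_eq_zero_of_forall_eq_zero fun r hr => ?_
    have h1 : ∫ θ in (-Real.pi)..Real.pi, (r * H2 (r, θ)) = 0 := by
      rw [intervalIntegral.integral_eq_sub_of_hasDerivAt (fun θ _ => hcθ r θ)]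
      · have : e Real.pi = e (-Real.pi) := by simp [he, Complex.exp_neg]
        simp [hcdef, this]
      · exact (continuous_const.mul (hH2c.comp (Continuous.prodMk_right r))).intervalIntegrable _ _
    rw [intervalIntegral.integral_of_le (by linarith [Real.pi_pos]),
      integral_Ioc_eq_integral_Ioo, integral_const_mul] at h1
    have hr' : (r : ℂ) ≠ 0 := by exact_mod_cast (ne_of_gt hr)
    exact (mul_eq_zero.1 h1).resolve_left hr'
  calc ∫ w, wirtingerBar f w * (w - z)⁻¹
      = ∫ w, wirtingerBar f (w + z) * (w + z - z)⁻¹ :=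
        (integral_add_right_eq_self (fun w => wirtingerBar f w * (w - z)⁻¹) z).symm
    _ = ∫ p in T, (1 / 2 : ℂ) * (H1 p + Complex.I * H2 p) := by
        rw [← Complex.integral_comp_polarCoord_symm]
        refine setIntegral_congr_fun (by simpa using hTm) ?_
        rintro ⟨r, θ⟩ hp
        have hr : (0 : ℝ) < r := hp.1
        have hr' : (r : ℂ) ≠ 0 := by exact_mod_cast hr.ne'
        have hsym : Complex.polarCoord.symm (r, θ) = r * e θ := by
          simp [Complex.polarCoord_symm_apply, he, Complex.exp_mul_I]
        have hlin : ∀ v : ℂ, fderiv ℝ f (c r θ) v =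
            v.re * fderiv ℝ f (c r θ) 1 + v.im * fderiv ℝ f (c r θ) Complex.I := fun v => by
          rw [← Complex.real_smul, ← Complex.real_smul, ← map_smul, ← map_smul, ← map_add]
          congr 1
          simp [Complex.re_add_im]
        have hconj : ((e θ).re - (e θ).im * Complex.I) * e θ = 1 := by
          have : ((e θ).re - (e θ).im * Complex.I : ℂ) = (starRingEnd ℂ) (e θ) := by
            apply Complex.ext <;> simp
          rw [this, Complex.conj_mul', he_norm]; simp
        have hinv : (e θ)⁻¹ = (e θ).re - (e θ).im * Complex.I :=
          (eq_inv_of_mul_eq_one_left hconj).symm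
        simp only [hsym, add_sub_cancel_right, hH1, hH2]
        rw [hlin (e θ), hlin (e θ * Complex.I), mul_inv, hinv]
        have : r * e θ + z = c r θ := by simp [hcdef, add_comm]
        rw [this, wirtingerBar, Complex.real_smul]
        simp only [Complex.mul_re, Complex.mul_im, Complex.I_re, Complex.I_im]
        push_cast
        field_simp
        ring_nf
        simp only [Complex.I_sq]
        ring
    _ = -Real.pi * f z := by
        have hH1i' : IntegrableOn H1 T := hH1i
        have hH2i' : IntegrableOn H2 T := hH2i
        rw [integral_const_mul, integral_add hH1i' (hH2i'.const_mul _), integral_const_mul, hI1, hI2]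
        ring

end CauchyPompeiu

/-! ### Functional calculus by Cauchy transforms -/

section CauchyTransform

variable {A : Type*} [CStarAlgebra A]

/-- Up to the factor `-1/π`, the Cauchy transform `∫ ∂f/∂w̄ (w - T)⁻¹ dw` computes `f T` for every
element `T` whose spectrum avoids the support of `∂f/∂w̄`. -/
noncomputable def cauchyTransform (f : ℂ → ℂ) (T : A) : A :=
  ∫ w, wirtingerBar f w • Ring.inverse (algebraMap ℂ A w - T)

theorem isUnit_algebraMap_sub_of_notMem_spectrum {T : A} {w : ℂ} (h : w ∉ spectrum ℂ T) :
    IsUnit (algebraMap ℂ A w - T) := spectrum.notMem_iff.1 h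

theorem cauchyTransform_eq_setIntegral (f : ℂ → ℂ) (T : A) :
    cauchyTransform f T = ∫ w in tsupport (wirtingerBar f),
      wirtingerBar f w • Ring.inverse (algebraMap ℂ A w - T) := by
  refine (MeasureTheory.setIntegral_eq_integral_of_forall_compl_eq_zero fun w hw => ?_).symm
  rw [image_eq_zero_of_notMem_tsupport hw, zero_smul]

theorem isCompact_tsupport_wirtingerBar {f : ℂ → ℂ} (hc : HasCompactSupport f) :
    IsCompact (tsupport (wirtingerBar f)) :=
  hc.of_isClosed_subset (isClosed_tsupport _) (tsupport_wirtingerBar_subset f)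

theorem isOpen_setOf_isUnit_algebraMap_sub :
    IsOpen {p : ℂ × A | IsUnit (algebraMap ℂ A p.1 - p.2)} :=
  Units.isOpen.preimage (((continuous_algebraMap ℂ A).comp continuous_fst).sub continuous_snd)

theorem continuousOn_inverse_algebraMap_sub :
    ContinuousOn (fun p : ℂ × A => Ring.inverse (algebraMap ℂ A p.1 - p.2))
      {p : ℂ × A | IsUnit (algebraMap ℂ A p.1 - p.2)} := by
  rintro ⟨w, T⟩ ⟨u, hu⟩
  refine ContinuousAt.continuousWithinAt ?_
  have h1 : ContinuousAt Ring.inverse (algebraMap ℂ A w - T) := by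
    rw [← hu]
    exact NormedRing.inverse_continuousAt u
  have h2 : Continuous fun p : ℂ × A => algebraMap ℂ A p.1 - p.2 :=
    ((continuous_algebraMap ℂ A).comp continuous_fst).sub continuous_snd
  exact ContinuousAt.comp (f := fun p : ℂ × A => algebraMap ℂ A p.1 - p.2) (x := (w, T)) h1
    h2.continuousAt

theorem continuousOn_cauchyTransform_integrand {f : ℂ → ℂ} (hf : ContDiff ℝ 1 f) {T : A} {s : Set ℂ}
    (hT : ∀ w ∈ s, IsUnit (algebraMap ℂ A w - T)) :
    ContinuousOn (fun w => wirtingerBar f w • Ring.inverse (algebraMap ℂ A w - T)) s := by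
  refine (continuous_wirtingerBar hf).continuousOn.smul ?_
  exact continuousOn_inverse_algebraMap_sub.comp
    (Continuous.prodMk_left T).continuousOn fun w hw => hT w hw

theorem algebraMap_sub_conj (T : A) (w : ℂ) (V : Aˣ) :
    algebraMap ℂ A w - (V : A) * T * ((V⁻¹ : Aˣ) : A) =
      V * (algebraMap ℂ A w - T) * ((V⁻¹ : Aˣ) : A) := by
  rw [mul_sub, sub_mul, ← Algebra.commutes w (V : A), mul_assoc (algebraMap ℂ A w), Units.mul_inv,
    mul_one]

theorem cauchyTransform_conj {f : ℂ → ℂ} (hf : ContDiff ℝ 1 f) (hc : HasCompactSupport f) {T : A}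
    (hT : Disjoint (tsupport (wirtingerBar f)) (spectrum ℂ T)) (V : Aˣ) :
    cauchyTransform f ((V : A) * T * ((V⁻¹ : Aˣ) : A)) =
      V * cauchyTransform f T * ((V⁻¹ : Aˣ) : A) := by
  have hint : MeasureTheory.IntegrableOn
      (fun w => wirtingerBar f w • Ring.inverse (algebraMap ℂ A w - T))
      (tsupport (wirtingerBar f)) :=
    (continuousOn_cauchyTransform_integrand hf fun w hw =>
      isUnit_algebraMap_sub_of_notMem_spectrum
        (Set.disjoint_left.1 hT hw)).integrableOn_compact (isCompact_tsupport_wirtingerBar hc)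
  have key : ∀ w, Ring.inverse (algebraMap ℂ A w - (V : A) * T * ((V⁻¹ : Aˣ) : A)) =
      V * Ring.inverse (algebraMap ℂ A w - T) * ((V⁻¹ : Aˣ) : A) := fun w => by
    rw [algebraMap_sub_conj]
    by_cases hu : IsUnit (algebraMap ℂ A w - T)
    · obtain ⟨u, hu⟩ := hu
      rw [← hu, Ring.inverse_unit, ← Units.val_mul, ← Units.val_mul, Ring.inverse_unit]
      simp [mul_assoc]
    · rw [Ring.inverse_non_unit _ hu, Ring.inverse_non_unit, mul_zero, zero_mul]
      rwa [Units.isUnit_mul_units, Units.isUnit_units_mul]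
  have hcomm := (ContinuousLinearMap.mulLeftRight ℂ A (V : A) ((V⁻¹ : Aˣ) : A)).integral_comp_comm
    hint
  simp only [ContinuousLinearMap.mulLeftRight_apply] at hcomm
  rw [cauchyTransform_eq_setIntegral, cauchyTransform_eq_setIntegral, ← hcomm]
  simp only [key, mul_smul_comm, smul_mul_assoc]

open Filter Topology in
theorem continuousAt_cauchyTransform {f : ℂ → ℂ} (hf : ContDiff ℝ 1 f) (hc : HasCompactSupport f)
    {T : A} (hT : Disjoint (tsupport (wirtingerBar f)) (spectrum ℂ T)) :
    ContinuousAt (fun T : A => cauchyTransform f T) T := by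
  set S := tsupport (wirtingerBar f) with hS
  have hSc : IsCompact S := isCompact_tsupport_wirtingerBar hc
  have hTu : ∀ w ∈ S, IsUnit (algebraMap ℂ A w - T) := fun w hw =>
    isUnit_algebraMap_sub_of_notMem_spectrum (Set.disjoint_left.1 hT hw)
  obtain ⟨C, hC⟩ := hSc.exists_bound_of_continuousOn
    (continuousOn_inverse_algebraMap_sub.comp (Continuous.prodMk_left T).continuousOn
      fun w hw => hTu w hw)
  obtain ⟨D, hD⟩ := hSc.exists_bound_of_continuousOn (continuous_wirtingerBar hf).continuousOn
  -- near `T`, the resolvents are bounded by `C + 1` uniformly on `S`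
  obtain ⟨u, v, hu, hv, hSu, hTv, huv⟩ := generalized_tube_lemma hSc (isCompact_singleton (x := T))
    (continuousOn_inverse_algebraMap_sub.norm.isOpen_inter_preimage
      isOpen_setOf_isUnit_algebraMap_sub (isOpen_Iio (a := C + 1))) (by
      rintro ⟨w, T'⟩ ⟨hw, hT'⟩
      obtain rfl : T' = T := hT'
      exact ⟨hTu w hw, lt_of_le_of_lt (hC w hw) (lt_add_one C)⟩)
  have hv' : v ∈ 𝓝 T := hv.mem_nhds (hTv rfl)
  simp only [cauchyTransform_eq_setIntegral]
  refine MeasureTheory.continuousAt_of_dominated (bound := fun _ => D * (C + 1)) ?_ ?_ ?_ ?_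
  · filter_upwards [hv'] with T' hT'
    exact (continuousOn_cauchyTransform_integrand (s := S) hf fun w hw =>
      (huv (Set.mk_mem_prod (hSu hw) hT')).1).aestronglyMeasurable
        (isClosed_tsupport _).measurableSet
  · filter_upwards [hv'] with T' hT'
    refine MeasureTheory.ae_restrict_of_forall_mem (isClosed_tsupport _).measurableSet
      fun w hw => ?_
    have h1 : ‖Ring.inverse (algebraMap ℂ A w - T')‖ < C + 1 :=
      (huv (Set.mk_mem_prod (hSu hw) hT')).2
    rw [norm_smul]
    exact mul_le_mul (hD w hw) h1.le (norm_nonneg _) ((norm_nonneg _).trans (hD w hw))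
  · exact MeasureTheory.integrableOn_const (by exact hSc.measure_lt_top.ne)
  · refine MeasureTheory.ae_restrict_of_forall_mem (isClosed_tsupport _).measurableSet
      fun w hw => ?_
    refine continuousAt_const.smul ?_
    have h1 : ContinuousAt (fun p : ℂ × A => Ring.inverse (algebraMap ℂ A p.1 - p.2)) (w, T) :=
      continuousOn_inverse_algebraMap_sub.continuousAt
        (isOpen_setOf_isUnit_algebraMap_sub.mem_nhds (hTu w hw))
    exact ContinuousAt.comp (f := fun T' : A => (w, T')) h1 (Continuous.prodMk_right w).continuousAt

theorem cauchyTransform_eq_cfc {f : ℂ → ℂ} (hf : ContDiff ℝ 1 f) (hc : HasCompactSupport f)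
    {T : A} (hn : IsStarNormal T) (hT : Disjoint (tsupport (wirtingerBar f)) (spectrum ℂ T)) :
    cauchyTransform f T = (-Real.pi : ℂ) • cfc f T := by
  set S := tsupport (wirtingerBar f) with hS
  have hSc : IsCompact S := isCompact_tsupport_wirtingerBar hc
  have hne : ∀ p ∈ S ×ˢ spectrum ℂ T, p.1 - p.2 ≠ 0 := fun p hp h =>
    Set.disjoint_left.1 hT hp.1 (sub_eq_zero.1 h ▸ hp.2)
  have hcont : ContinuousOn (fun p : ℂ × ℂ => wirtingerBar f p.1 * (p.1 - p.2)⁻¹)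
      (S ×ˢ spectrum ℂ T) :=
    ((continuous_wirtingerBar hf).comp continuous_fst).continuousOn.mul
      ((continuous_fst.sub continuous_snd).continuousOn.inv₀ hne)
  obtain ⟨C, hC⟩ := (hSc.prod (spectrum.isCompact T)).exists_bound_of_continuousOn hcont
  have h1 : cfc (fun z => ∫ w in S, wirtingerBar f w * (w - z)⁻¹) T =
      ∫ w in S, cfc (fun z => wirtingerBar f w * (w - z)⁻¹) T := by
    refine cfc_setIntegral (isClosed_tsupport _).measurableSet
      (fun w z => wirtingerBar f w * (w - z)⁻¹) (fun _ => C) T hcont ?_ ?_ hn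
    · exact MeasureTheory.ae_restrict_of_forall_mem (isClosed_tsupport _).measurableSet
        fun w hw z hz => hC (w, z) ⟨hw, hz⟩
    · exact (MeasureTheory.integrableOn_const (C := C) (by exact hSc.measure_lt_top.ne)).2
  have h2 : ∀ z, ∫ w in S, wirtingerBar f w * (w - z)⁻¹ = -Real.pi * f z := fun z => by
    rw [← integral_wirtingerBar_mul_inv hf hc z]
    refine MeasureTheory.setIntegral_eq_integral_of_forall_compl_eq_zero fun w hw => ?_
    rw [image_eq_zero_of_notMem_tsupport hw, zero_mul]
  have h3 : ∫ w in S, cfc (fun z => wirtingerBar f w * (w - z)⁻¹) T = cauchyTransform f T := by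
    rw [cauchyTransform_eq_setIntegral]
    refine MeasureTheory.setIntegral_congr_fun (isClosed_tsupport _).measurableSet fun w hw => ?_
    have hw0 : ∀ z ∈ spectrum ℂ T, w - z ≠ 0 := fun z hz => hne (w, z) ⟨hw, hz⟩
    have hcw : ContinuousOn (fun z : ℂ => w - z) (spectrum ℂ T) := by fun_prop
    rw [cfc_const_mul (wirtingerBar f w) (fun z => (w - z)⁻¹) T (hcw.inv₀ hw0), cfc_inv _ _ hw0 hcw, cfc_sub _ _ _, cfc_const w T,
      cfc_id' ℂ T]
  rw [← h3, ← h1]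
  simp only [h2]
  rw [cfc_const_mul _ _ _ hf.continuous.continuousOn]

/-- The spectral inclusion that survives limits of similarities: `f N` is the limit of conjugates
of `f M` as soon as `f` is holomorphic near the spectrum of `N`. -/
theorem eqOn_zero_spectrum_of_mem_closure {M N : A} (hM : IsStarNormal M) (hN : IsStarNormal N)
    (h : N ∈ closure (similarityOrbit M)) (hMN : spectrum ℂ M ⊆ spectrum ℂ N)
    {f : ℂ → ℂ} (hf : ContDiff ℝ 1 f) (hc : HasCompactSupport f)
    (hd : Disjoint (tsupport (wirtingerBar f)) (spectrum ℂ N))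
    (h0 : ∀ z ∈ spectrum ℂ M, f z = 0) : ∀ z ∈ spectrum ℂ N, f z = 0 := by
  have hdM : Disjoint (tsupport (wirtingerBar f)) (spectrum ℂ M) := hd.mono_right hMN
  have hM0 : cauchyTransform f M = 0 := by
    rw [cauchyTransform_eq_cfc hf hc hM hdM, cfc_congr (g := fun _ => 0) (fun z hz => h0 z hz)]
    simp
  have hN0 : cauchyTransform f N = 0 := by
    obtain ⟨T, hT, hlim⟩ := mem_closure_iff_seq_limit.1 h
    refine tendsto_nhds_unique ((continuousAt_cauchyTransform hf hc hd).tendsto.comp hlim) ?_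
    refine tendsto_const_nhds.congr fun n => ?_
    obtain ⟨V, hV⟩ := hT n
    simp [hV, cauchyTransform_conj hf hc hdM, hM0]
  rw [cauchyTransform_eq_cfc hf hc hN hd] at hN0
  have hcf : cfc f N = 0 := by
    refine (smul_eq_zero.1 hN0).resolve_left ?_
    simp [Real.pi_ne_zero]
  intro z hz
  have := norm_apply_le_norm_cfc f N hz hf.continuous.continuousOn hN
  rw [hcf, norm_zero] at this
  exact norm_le_zero_iff.1 this

theorem spectrum_subset_of_mem_closure {M N : A} (h : N ∈ closure (similarityOrbit M)) :
    spectrum ℂ M ⊆ spectrum ℂ N := by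
  intro w hw
  by_contra hn
  have ho : IsOpen {T : A | IsUnit (algebraMap ℂ A w - T)} :=
    Units.isOpen.preimage (continuous_const.sub continuous_id)
  obtain ⟨T, hT, V, rfl⟩ := mem_closure_iff.1 h _ ho (spectrum.notMem_iff.1 hn)
  rw [Set.mem_ofPred_eq, algebraMap_sub_conj, Units.isUnit_mul_units, Units.isUnit_units_mul] at hT
  exact hw hT

theorem resolventInIdentityComponent_of_mem_closure {M N : A}
    (h : N ∈ closure (similarityOrbit M)) (hM : ResolventInIdentityComponent M) :
    ResolventInIdentityComponent N := by
  intro w hw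
  have hu : IsUnit (algebraMap ℂ A w - N) := spectrum.notMem_iff.1 hw
  have hwM : w ∉ spectrum ℂ M := fun h' => hw (spectrum_subset_of_mem_closure h h')
  have : LocallyConnectedSpace A := inferInstance
  have hopen : IsOpen (connectedComponentIn {a : A | IsUnit a} (algebraMap ℂ A w - N)) :=
    Units.isOpen.connectedComponentIn
  obtain ⟨T, hT, V, rfl⟩ := mem_closure_iff.1 h _
    (hopen.preimage (continuous_const.sub continuous_id : Continuous fun T : A => algebraMap ℂ A w - T))
    (mem_connectedComponentIn hu)
  change algebraMap ℂ A w - (V : A) * M * ((V⁻¹ : Aˣ) : A) ∈ connectedComponentIn _ _ at hT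
  rw [algebraMap_sub_conj] at hT
  -- conjugation by `V` maps the identity component into itself
  have hconj : (V : A) * (algebraMap ℂ A w - M) * ((V⁻¹ : Aˣ) : A) ∈
      connectedComponentIn {a : A | IsUnit a} 1 := by
    have hpre : IsPreconnected ((fun a : A => (V : A) * a * ((V⁻¹ : Aˣ) : A)) ''
        connectedComponentIn {a : A | IsUnit a} 1) :=
      isPreconnected_connectedComponentIn.image _ (by fun_prop)
    refine hpre.subset_connectedComponentIn ⟨1, mem_connectedComponentIn isUnit_one, by simp⟩ ?_
      ⟨_, hM w hwM, rfl⟩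
    rintro _ ⟨a, ha, rfl⟩
    have hau : IsUnit a := connectedComponentIn_subset {a : A | IsUnit a} 1 ha
    simpa [Units.isUnit_mul_units, Units.isUnit_units_mul] using hau
  have e1 := connectedComponentIn_eq hT
  have e2 := connectedComponentIn_eq hconj
  show _ ∈ connectedComponentIn {a : A | IsUnit a} 1
  rw [e2, ← e1]
  exact mem_connectedComponentIn hu

end CauchyTransform

/-! ### Clopen parts of the spectrum of a limit of similarities -/

section ClopenParts

variable {A : Type*} [CStarAlgebra A]

open Filter Topology in
theorem wirtingerBar_eq_zero_of_eventuallyEq {f g : ℂ → ℂ} (hg : Differentiable ℂ g) {z : ℂ}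
    (h : f =ᶠ[𝓝 z] g) : z ∉ tsupport (wirtingerBar f) := by
  rw [notMem_tsupport_iff_eventuallyEq]
  filter_upwards [h.eventuallyEq_nhds] with w hw
  have h1 : wirtingerBar f w = wirtingerBar g w := by
    unfold wirtingerBar
    rw [hw.fderiv_eq]
  rw [h1, wirtingerBar_eq_zero_of_differentiableAt (hg w), Pi.zero_apply]

open Filter Topology in
/-- A smooth compactly supported extension of the function equal to the entire function `p` near
`Z` and to zero near `Z'`. -/
theorem exists_contDiff_eq_near {Z Z' : Set ℂ} (hZ : IsCompact Z) (hZ' : IsCompact Z')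
    (hd : Disjoint Z Z') {p : ℂ → ℂ} (hp : Differentiable ℂ p) :
    ∃ f : ℂ → ℂ, ContDiff ℝ 1 f ∧ HasCompactSupport f ∧ (∀ z ∈ Z, f z = p z) ∧
      (∀ z ∈ Z', f z = 0) ∧ Disjoint (tsupport (wirtingerBar f)) (Z ∪ Z') := by
  obtain ⟨R, hR⟩ := hZ.isBounded.subset_ball 0
  obtain ⟨χ, h0, h1, -⟩ := exists_contMDiffMap_zero_one_nhds_of_isClosed (n := 1)
    (modelWithCornersSelf ℝ ℂ) (s := Z' ∪ (Metric.ball (0 : ℂ) R)ᶜ) (t := Z)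
    (hZ'.isClosed.union Metric.isOpen_ball.isClosed_compl) hZ.isClosed
    (Set.disjoint_union_left.2 ⟨hd.symm, Set.disjoint_left.2 fun z hz hz' => hz (hR hz')⟩)
  have hχ : ContDiff ℝ 1 χ := χ.contMDiff.contDiff
  have h0' : ∀ z ∈ Z' ∪ (Metric.ball (0 : ℂ) R)ᶜ, ∀ᶠ w in 𝓝 z, χ w = 0 := fun z hz =>
    h0.filter_mono (nhds_le_nhdsSet hz)
  have h1' : ∀ z ∈ Z, ∀ᶠ w in 𝓝 z, χ w = 1 := fun z hz => h1.filter_mono (nhds_le_nhdsSet hz)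
  refine ⟨fun z => (χ z : ℂ) * p z, ?_, ?_, ?_, ?_, ?_⟩
  · exact (Complex.ofRealCLM.contDiff.comp hχ).mul (hp.contDiff.restrict_scalars ℝ)
  · refine HasCompactSupport.intro (isCompact_closedBall (0 : ℂ) R) fun z hz => ?_
    have : χ z = 0 := (h0' z (Or.inr fun h => hz (Metric.ball_subset_closedBall h))).self_of_nhds
    simp [this]
  · intro z hz
    simp [(h1' z hz).self_of_nhds]
  · intro z hz
    simp [(h0' z (Or.inl hz)).self_of_nhds]
  · refine Set.disjoint_left.2 fun z hz hz' => ?_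
    rcases hz' with hz' | hz'
    · refine wirtingerBar_eq_zero_of_eventuallyEq hp ?_ hz
      filter_upwards [h1' z hz'] with w hw
      simp [hw]
    · refine wirtingerBar_eq_zero_of_eventuallyEq (differentiable_const 0) ?_ hz
      filter_upwards [h0' z (Or.inl hz')] with w hw
      simp [hw]

/-- If a clopen part `Z` of the spectrum of a limit `N` of conjugates of `M` meets the spectrum of
`M` in a finite set `F`, then `∏ (N - μ)` over `μ ∈ F` vanishes on the part of `N` living on `Z`,
so `Z` cannot contain any further point. -/
theorem subset_spectrum_of_finite_inter {M N : A} (hM : IsStarNormal M) (hN : IsStarNormal N)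
    (h : N ∈ closure (similarityOrbit M)) {Z Z' : Set ℂ} (hZ : IsCompact Z) (hZ' : IsCompact Z')
    (hd : Disjoint Z Z') (hσ : Z ∪ Z' = spectrum ℂ N) (hfin : (Z ∩ spectrum ℂ M).Finite) :
    Z ⊆ spectrum ℂ M := by
  have hMN := spectrum_subset_of_mem_closure h
  set p : ℂ → ℂ := fun z => ∏ μ ∈ hfin.toFinset, (z - μ) with hp
  have hpd : Differentiable ℂ p := by
    simp only [hp]
    fun_prop
  obtain ⟨f, hf, hc, hfZ, hfZ', hdis⟩ := exists_contDiff_eq_near hZ hZ' hd hpd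
  rw [hσ] at hdis
  have h0 := eqOn_zero_spectrum_of_mem_closure hM hN h hMN hf hc hdis fun z hz => by
    rcases hσ.symm ▸ hMN hz with hzZ | hzZ
    · rw [hfZ z hzZ]
      exact Finset.prod_eq_zero (hfin.mem_toFinset.2 ⟨hzZ, hz⟩) (sub_self z)
    · exact hfZ' z hzZ
  intro z hz
  have h1 := h0 z (hσ ▸ Or.inl hz)
  rw [hfZ z hz] at h1
  obtain ⟨μ, hμ, hzμ⟩ := Finset.prod_eq_zero_iff.1 h1
  rw [sub_eq_zero.1 hzμ]
  exact (hfin.mem_toFinset.1 hμ).2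

/-- In a compact set, components are intersections of relatively clopen sets. -/
theorem exists_separation_of_connectedComponentIn_subset {K U : Set ℂ} (hK : IsCompact K) {z : ℂ}
    (hz : z ∈ K) (hU : IsOpen U) (hzU : connectedComponentIn K z ⊆ U) :
    ∃ Z Z' : Set ℂ, IsCompact Z ∧ IsCompact Z' ∧ Disjoint Z Z' ∧ Z ∪ Z' = K ∧ z ∈ Z ∧ Z ⊆ U := by
  have : CompactSpace K := isCompact_iff_compactSpace.1 hK
  set x : K := ⟨z, hz⟩
  have : Nonempty {s : Set K // IsClopen s ∧ x ∈ s} := ⟨⟨Set.univ, isClopen_univ, trivial⟩⟩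
  obtain ⟨⟨s, hs, hxs⟩, hsU⟩ := exists_subset_nhds_of_isCompact
    (V := fun s : {s : Set K // IsClopen s ∧ x ∈ s} => (s : Set K)) (U := Subtype.val ⁻¹' U) (by
      rintro ⟨s, hs, hxs⟩ ⟨t, ht, hxt⟩
      exact ⟨⟨s ∩ t, hs.inter ht, hxs, hxt⟩, Set.inter_subset_left, Set.inter_subset_right⟩)
    (fun s => s.2.1.1.isCompact) (by
      intro y hy
      rw [← connectedComponent_eq_iInter_isClopen] at hy
      refine (hU.preimage continuous_subtype_val).mem_nhds (hzU ?_)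
      rw [connectedComponentIn_eq_image hz]
      exact ⟨y, hy, rfl⟩)
  refine ⟨Subtype.val '' s, Subtype.val '' sᶜ, hs.1.isCompact.image continuous_subtype_val,
    hs.compl.1.isCompact.image continuous_subtype_val, ?_, ?_, ⟨x, hxs, rfl⟩, ?_⟩
  · exact (Set.disjoint_image_iff Subtype.val_injective).2 disjoint_compl_right
  · rw [← Set.image_union, Set.union_compl_self, Set.image_univ, Subtype.range_coe]
  · rintro _ ⟨y, hy, rfl⟩
    exact hsU hy

theorem connectedComponentIn_inter_spectrum_nonempty {M N : A} (hM : IsStarNormal M)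
    (hN : IsStarNormal N) (h : N ∈ closure (similarityOrbit M)) {z : ℂ} (hz : z ∈ spectrum ℂ N) :
    (connectedComponentIn (spectrum ℂ N) z ∩ spectrum ℂ M).Nonempty := by
  by_contra hne
  obtain ⟨Z, Z', hZ, hZ', hd, hσ, hzZ, hZU⟩ := exists_separation_of_connectedComponentIn_subset
    (spectrum.isCompact (𝕜 := ℂ) N) hz (spectrum.isClosed (𝕜 := ℂ) M).isOpen_compl
    fun y hy hyM => hne ⟨y, hy, hyM⟩
  have hemp : Z ∩ spectrum ℂ M = ∅ :=
    Set.eq_empty_of_forall_notMem fun y hy => hZU hy.1 hy.2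
  exact hZU hzZ (subset_spectrum_of_finite_inter hM hN h hZ hZ' hd hσ (by simp [hemp]) hzZ)

open Filter Topology in
theorem exists_isNonIsolatedPoint_of_mem_closure {M N : A} (hM : IsStarNormal M)
    (hN : IsStarNormal N) (h : N ∈ closure (similarityOrbit M)) {z : ℂ}
    (hz : IsNonIsolatedPoint (spectrum ℂ N) z) :
    ∃ μ ∈ connectedComponentIn (spectrum ℂ N) z, IsNonIsolatedPoint (spectrum ℂ M) μ := by
  by_contra! hcon
  set C := connectedComponentIn (spectrum ℂ N) z with hC
  have hσN : IsCompact (spectrum ℂ N) := spectrum.isCompact N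
  have hσM : IsClosed (spectrum ℂ M) := spectrum.isClosed M
  have hCc : IsCompact C := by
    have : CompactSpace (spectrum ℂ N) := isCompact_iff_compactSpace.1 hσN
    rw [hC, connectedComponentIn_eq_image hz.1]
    exact isClosed_connectedComponent.isCompact.image continuous_subtype_val
  have hloc : ∀ y ∈ C, ∃ U : Set ℂ, IsOpen U ∧ y ∈ U ∧ U ∩ spectrum ℂ M ⊆ {y} := fun y hy => by
    by_cases hyM : y ∈ spectrum ℂ M
    · have : ¬ AccPt y (𝓟 (spectrum ℂ M)) := fun h' => hcon y hy ⟨hyM, h'⟩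
      rw [accPt_iff_nhds] at this
      push Not at this
      obtain ⟨U, hU, hU'⟩ := this
      obtain ⟨V, hVU, hV, hyV⟩ := mem_nhds_iff.1 hU
      exact ⟨V, hV, hyV, fun w hw => hU' w ⟨hVU hw.1, hw.2⟩⟩
    · exact ⟨(spectrum ℂ M)ᶜ, hσM.isOpen_compl, hyM, fun w hw => absurd hw.2 hw.1⟩
  choose! U hUo hyU hU using hloc
  obtain ⟨t, htC, htU⟩ := hCc.elim_nhds_subcover U fun y hy => (hUo y hy).mem_nhds (hyU y hy)
  obtain ⟨Z, Z', hZ, hZ', hd, hσ, hzZ, hZU⟩ := exists_separation_of_connectedComponentIn_subset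
    hσN hz.1 (isOpen_biUnion fun y hy => hUo y (htC y hy)) htU
  have hfin : (Z ∩ spectrum ℂ M).Finite := by
    refine t.finite_toSet.subset fun w hw => ?_
    obtain ⟨y, hy, hwy⟩ := Set.mem_iUnion₂.1 (hZU hw.1)
    rw [hU y (htC y hy) ⟨hwy, hw.2⟩]
    exact hy
  have hZM := subset_spectrum_of_finite_inter hM hN h hZ hZ' hd hσ hfin
  have hZfin : Z.Finite := hfin.subset fun w hw => ⟨hw, hZM hw⟩
  have hacc := hz.2
  rw [← hσ, ← sup_principal, accPt_sup] at hacc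
  rcases hacc with hacc | hacc
  · exact Set.Infinite.of_accPt hacc hZfin
  · exact Set.disjoint_left.1 hd hzZ (hZ'.isClosed.closure_eq ▸ hacc.clusterPt.mem_closure)

end ClopenParts

/-! ### Partitions into projections and diagonal elements -/

section Diagonal

/-- The form in which pure infiniteness and triviality of `K₀` enter: every non-zero projection is
the sum of two non-zero projections, and all non-zero projections are equivalent. -/
structure HasInterchangeableProjections (A : Type*) [CStarAlgebra A] : Prop where
  exists_add_eq : ∀ p : A, IsStarProjection p → p ≠ 0 →
    ∃ e f : A, IsStarProjection e ∧ IsStarProjection f ∧ e ≠ 0 ∧ f ≠ 0 ∧ e * f = 0 ∧ e + f = p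
  mvNEquiv : ∀ p q : A, IsStarProjection p → IsStarProjection q → p ≠ 0 → q ≠ 0 → MvNEquiv p q

/-- A finite family of non-zero projections with sum `1`, orthogonal to each other. -/
structure IsProjectionPartition {A : Type*} [CStarAlgebra A] {ι : Type*} [Fintype ι]
    (p : ι → A) : Prop where
  proj : ∀ i, IsStarProjection (p i)
  ne_zero : ∀ i, p i ≠ 0
  orthogonal : ∀ i j, i ≠ j → p i * p j = 0
  sum_eq_one : ∑ i, p i = 1

/-- `a` is a diagonal element with the eigenvalues `lam i`, repetitions allowed. Each eigenvalue
carries a non-zero projection, so its multiplicity is infinite in the situation of interest. -/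
def IsDiagonal {A : Type*} [CStarAlgebra A] {ι : Type*} [Fintype ι] (lam : ι → ℂ) (a : A) : Prop :=
  ∃ p : ι → A, IsProjectionPartition p ∧ a = ∑ i, lam i • p i

variable {A : Type*} [CStarAlgebra A]

theorem IsStarProjection.eq_of_mvN {v p : A} (hp : IsStarProjection p) (h : star v * v = p) :
    v * p = v := by
  have h2 : p * p = p := hp.isIdempotentElem
  have h3 : star p = p := hp.isSelfAdjoint
  have : star (v * p - v) * (v * p - v) = 0 := by
    rw [star_sub, star_mul, h3]
    calc (p * star v - star v) * (v * p - v)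
        = p * (star v * v) * p - p * (star v * v) - (star v * v) * p + star v * v := by noncomm_ring
      _ = 0 := by rw [h, h2, h2]; abel
  exact sub_eq_zero.1 ((CStarRing.star_mul_self_eq_zero_iff _).1 this)

theorem IsStarProjection.mul_eq_of_mvN {v q : A} (hq : IsStarProjection q) (h : v * star v = q) :
    q * v = v := by
  have h1 := hq.eq_of_mvN (v := star v) (by rw [star_star, h])
  have h2 := congrArg star h1
  rwa [star_mul, star_star, hq.isSelfAdjoint.star_eq] at h2

theorem hasInterchangeableProjections_of_isProperlyInfinite
    (hinf : ∀ p : A, IsStarProjection p → p ≠ 0 → IsProperlyInfinite p)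
    (hequiv : ∀ p q : A, IsStarProjection p → IsStarProjection q → p ≠ 0 → q ≠ 0 → MvNEquiv p q) :
    HasInterchangeableProjections A := by
  refine ⟨fun p hp hp0 => ?_, hequiv⟩
  obtain ⟨e, f, he, hf, hpe, hpf, hef, ⟨v, hv, hve⟩, ⟨w, hw, hwf⟩⟩ := hinf p hp hp0
  have hep : e * p = e := by
    have := congrArg star hpe
    rwa [star_mul, he.isSelfAdjoint.star_eq, hp.isSelfAdjoint.star_eq] at this
  have ne : ∀ {u q : A}, IsStarProjection q → star u * u = p → u * star u = q → q ≠ 0 :=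
    fun {u q} hq h1 h2 h0 => by
      have := hq.mul_eq_of_mvN h2
      rw [h0, zero_mul] at this
      rw [← this, mul_zero] at h1
      exact hp0 h1.symm
  refine ⟨e, p - e, he, ?_, ne he hv hve, ?_, ?_, by abel⟩
  · refine ⟨?_, hp.isSelfAdjoint.sub he.isSelfAdjoint⟩
    have h1 : p * p = p := hp.isIdempotentElem
    have h2 : e * e = e := he.isIdempotentElem
    show (p - e) * (p - e) = p - e
    rw [mul_sub, sub_mul, sub_mul, h1, h2, hpe, hep]
    abel
  · intro h
    have hf0 : f = 0 := by
      rw [← hpf, sub_eq_zero.1 h, hef]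
    exact ne hf hw hwf hf0
  · rw [mul_sub, hep, he.isIdempotentElem.eq, sub_self]

open Classical in
theorem HasInterchangeableProjections.exists_split (hA : HasInterchangeableProjections A)
    {κ : Type*} (s : Finset κ) (hs : s.Nonempty) : ∀ p : A, IsStarProjection p → p ≠ 0 →
      ∃ q : κ → A, (∀ k ∈ s, IsStarProjection (q k)) ∧ (∀ k ∈ s, q k ≠ 0) ∧
        (∀ k ∈ s, ∀ l ∈ s, k ≠ l → q k * q l = 0) ∧ ∑ k ∈ s, q k = p := by
  induction hs using Finset.Nonempty.cons_induction with
  | singleton a =>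
    intro p hp hp0
    refine ⟨fun _ => p, by simpa using hp, by simpa using hp0, ?_, by simp⟩
    intro k hk l hl hkl
    rw [Finset.mem_singleton] at hk hl
    exact absurd (hk.trans hl.symm) hkl
  | cons a s ha hs ih =>
    intro p hp hp0
    obtain ⟨e, f, he, hf, he0, hf0, hef, rfl⟩ := hA.exists_add_eq p hp hp0
    obtain ⟨q, hq, hq0, hqo, hqs⟩ := ih f hf hf0
    have hne : ∀ k ∈ s, k ≠ a := fun k hk h => ha (h ▸ hk)
    have hfq : ∀ k ∈ s, f * q k = q k := fun k hk => by
      rw [← hqs, Finset.sum_mul, Finset.sum_eq_single_of_mem k hk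
        fun l hl hlk => hqo l hl k hk hlk]
      exact (hq k hk).isIdempotentElem
    have heq : ∀ k ∈ s, e * q k = 0 := fun k hk => by
      rw [← hfq k hk, ← mul_assoc, hef, zero_mul]
    have hqe : ∀ k ∈ s, q k * e = 0 := fun k hk => by
      have := congrArg star (heq k hk)
      rwa [star_mul, he.isSelfAdjoint.star_eq, (hq k hk).isSelfAdjoint.star_eq, star_zero] at this
    refine ⟨Function.update q a e, ?_, ?_, ?_, ?_⟩
    · intro k hk
      rcases Finset.mem_cons.1 hk with rfl | hk
      · simpa using he
      · rw [Function.update_of_ne (hne k hk)]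
        exact hq k hk
    · intro k hk
      rcases Finset.mem_cons.1 hk with rfl | hk
      · simpa using he0
      · rw [Function.update_of_ne (hne k hk)]
        exact hq0 k hk
    · intro k hk l hl hkl
      rcases Finset.mem_cons.1 hk with rfl | hk <;> rcases Finset.mem_cons.1 hl with rfl | hl
      · exact absurd rfl hkl
      · rw [Function.update_self, Function.update_of_ne (hne l hl)]
        exact heq l hl
      · rw [Function.update_self, Function.update_of_ne (hne k ‹_›)]
        exact hqe k ‹_›
      · rw [Function.update_of_ne (hne k ‹_›), Function.update_of_ne (hne l hl)]
        exact hqo k ‹_› l hl hkl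
    · rw [Finset.sum_cons, Function.update_self, ← hqs]
      congr 1
      exact Finset.sum_congr rfl fun k hk => Function.update_of_ne (hne k hk) _ _

open Classical in
/-- A partition can be refined along any surjection onto its index set. -/
theorem IsProjectionPartition.exists_refinement (hA : HasInterchangeableProjections A)
    {ι κ : Type*} [Fintype ι] [Fintype κ] {p : ι → A} (hp : IsProjectionPartition p) {f : κ → ι}
    (hf : Function.Surjective f) :
    ∃ q : κ → A, IsProjectionPartition q ∧ ∀ i, ∑ k with f k = i, q k = p i := by
  have hne : ∀ i, (Finset.univ.filter fun k => f k = i).Nonempty := fun i => by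
    obtain ⟨k, hk⟩ := hf i
    exact ⟨k, by simp [hk]⟩
  choose q hq hq0 hqo hqs using fun i => hA.exists_split _ (hne i) (p i) (hp.proj i) (hp.ne_zero i)
  have hmem : ∀ k, k ∈ Finset.univ.filter fun l => f l = f k := fun k => by simp
  have hpq : ∀ k, p (f k) * q (f k) k = q (f k) k := fun k => by
    rw [← hqs, Finset.sum_mul, Finset.sum_eq_single_of_mem k (hmem k)
      fun l hl hlk => hqo _ l hl k (hmem k) hlk]
    exact (hq _ k (hmem k)).isIdempotentElem
  have hqp : ∀ k, q (f k) k * p (f k) = q (f k) k := fun k => by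
    have := congrArg star (hpq k)
    rwa [star_mul, (hp.proj _).isSelfAdjoint.star_eq,
      (hq _ k (hmem k)).isSelfAdjoint.star_eq] at this
  have hfib : ∀ i, ∑ k with f k = i, q (f k) k = p i := fun i => by
    rw [← hqs i]
    refine Finset.sum_congr rfl fun k hk => ?_
    rw [(Finset.mem_filter.1 hk).2]
  refine ⟨fun k => q (f k) k, ⟨fun k => hq _ k (hmem k), fun k => hq0 _ k (hmem k), ?_, ?_⟩, hfib⟩
  · intro k l hkl
    by_cases h : f k = f l
    · have hl : l ∈ Finset.univ.filter fun l => f l = f k := by simp [h]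
      show q (f k) k * q (f l) l = 0
      rw [← h]
      exact hqo _ k (hmem k) l hl hkl
    · show q (f k) k * q (f l) l = 0
      rw [← hqp k, ← hpq l, mul_assoc, ← mul_assoc (p (f k)), hp.orthogonal _ _ h, zero_mul,
        mul_zero]
  · rw [← hp.sum_eq_one, ← Finset.sum_fiberwise (s := Finset.univ) (g := f)]
    exact Finset.sum_congr rfl fun i _ => hfib i

theorem IsDiagonal.comp_surjective (hA : HasInterchangeableProjections A)
    {ι κ : Type*} [Fintype ι] [Fintype κ] {lam : ι → ℂ} {a : A} (ha : IsDiagonal lam a) {f : κ → ι}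
    (hf : Function.Surjective f) : IsDiagonal (lam ∘ f) a := by
  classical
  obtain ⟨p, hp, rfl⟩ := ha
  obtain ⟨q, hq, hqp⟩ := hp.exists_refinement hA hf
  refine ⟨q, hq, ?_⟩
  rw [← Finset.sum_fiberwise (s := Finset.univ) (g := f)]
  refine Finset.sum_congr rfl fun i _ => ?_
  rw [← hqp i, Finset.smul_sum]
  refine Finset.sum_congr (Finset.filter_congr fun _ _ => Iff.rfl) fun k hk => ?_
  rw [Function.comp_apply, (Finset.mem_filter.1 hk).2]

theorem HasInterchangeableProjections.exists_isDiagonal [Nontrivial A]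
    (hA : HasInterchangeableProjections A) {ι : Type*} [Fintype ι] [Nonempty ι] (lam : ι → ℂ) :
    ∃ a : A, IsDiagonal lam a := by
  obtain ⟨q, hq, hq0, hqo, hqs⟩ := hA.exists_split (Finset.univ : Finset ι)
    Finset.univ_nonempty 1 (IsStarProjection.one A) one_ne_zero
  exact ⟨_, q, ⟨fun i => hq i (Finset.mem_univ i), fun i => hq0 i (Finset.mem_univ i),
    fun i j => hqo i (Finset.mem_univ i) j (Finset.mem_univ j), hqs⟩, rfl⟩

/-- The star homomorphism `c ↦ ∑ i, c i • p i` attached to a partition `p`. -/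
noncomputable def IsProjectionPartition.diagonalHom {ι : Type*} [Fintype ι] {p : ι → A}
    (hp : IsProjectionPartition p) : (ι → ℂ) →⋆ₙₐ[ℂ] A where
  toFun c := ∑ i, c i • p i
  map_smul' r c := by simp [Finset.smul_sum, mul_smul]
  map_zero' := by simp
  map_add' c d := by simp [add_smul, Finset.sum_add_distrib]
  map_mul' c d := by
    classical
    rw [Finset.sum_mul]
    refine Finset.sum_congr rfl fun i _ => ?_
    rw [Finset.mul_sum, Finset.sum_eq_single i]
    · rw [smul_mul_smul_comm, (hp.proj i).isIdempotentElem.eq, Pi.mul_apply]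
    · intro j _ hji
      rw [smul_mul_smul_comm, hp.orthogonal i j hji.symm, smul_zero]
    · simp
  map_star' c := by
    rw [star_sum]
    exact Finset.sum_congr rfl fun i _ => by
      rw [star_smul, (hp.proj i).isSelfAdjoint.star_eq, Pi.star_apply]

theorem IsProjectionPartition.norm_sum_smul_le {ι : Type*} [Fintype ι] {p : ι → A}
    (hp : IsProjectionPartition p) {c : ι → ℂ} {C : ℝ} (hC : 0 ≤ C) (hc : ∀ i, ‖c i‖ ≤ C) :
    ‖∑ i, c i • p i‖ ≤ C :=
  (NonUnitalStarAlgHom.norm_apply_le hp.diagonalHom c).trans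
    ((pi_norm_le_iff_of_nonneg hC).2 hc)

theorem IsDiagonal.exists_near {ι : Type*} [Fintype ι] {lam lam' : ι → ℂ} {a : A}
    (ha : IsDiagonal lam a) {C : ℝ} (hC : 0 ≤ C) (hc : ∀ i, ‖lam i - lam' i‖ ≤ C) :
    ∃ b, IsDiagonal lam' b ∧ ‖a - b‖ ≤ C := by
  obtain ⟨p, hp, rfl⟩ := ha
  refine ⟨_, ⟨p, hp, rfl⟩, ?_⟩
  rw [← Finset.sum_sub_distrib]
  simp only [← sub_smul]
  exact hp.norm_sum_smul_le hC hc

theorem IsDiagonal.exists_unitary_conj (hA : HasInterchangeableProjections A) {ι : Type*}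
    [Fintype ι] {lam : ι → ℂ} {a b : A} (ha : IsDiagonal lam a) (hb : IsDiagonal lam b) :
    ∃ u : unitary A, (u : A) * a * star (u : A) = b := by
  classical
  obtain ⟨p, hp, rfl⟩ := ha
  obtain ⟨q, hq, rfl⟩ := hb
  choose v hv hv' using fun i => hA.mvNEquiv (p i) (q i) (hp.proj i) (hq.proj i) (hp.ne_zero i)
    (hq.ne_zero i)
  have hvp : ∀ i, v i * p i = v i := fun i => (hp.proj i).eq_of_mvN (hv i)
  have hqv : ∀ i, q i * v i = v i := fun i => (hq.proj i).mul_eq_of_mvN (hv' i)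
  have hpv : ∀ i, p i * star (v i) = star (v i) := fun i => by
    have := congrArg star (hvp i)
    rwa [star_mul, (hp.proj i).isSelfAdjoint.star_eq] at this
  have hvq : ∀ i, star (v i) * q i = star (v i) := fun i => by
    have := congrArg star (hqv i)
    rwa [star_mul, (hq.proj i).isSelfAdjoint.star_eq] at this
  have h1 : ∀ i j, i ≠ j → star (v i) * v j = 0 := fun i j hij => by
    rw [← hvq i, ← hqv j, mul_assoc, ← mul_assoc (q i), hq.orthogonal i j hij, zero_mul, mul_zero]
  have h2 : ∀ i j, i ≠ j → v i * star (v j) = 0 := fun i j hij => by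
    rw [← hvp i, ← hpv j, mul_assoc, ← mul_assoc (p i), hp.orthogonal i j hij, zero_mul, mul_zero]
  have hvpo : ∀ i j, i ≠ j → v i * p j = 0 := fun i j hij => by
    rw [← hvp i, mul_assoc, hp.orthogonal i j hij, mul_zero]
  refine ⟨⟨∑ i, v i, ?_⟩, ?_⟩
  · rw [Unitary.mem_iff, star_sum, Finset.sum_mul, Finset.sum_mul]
    constructor
    · rw [← hp.sum_eq_one]
      refine Finset.sum_congr rfl fun i _ => ?_
      rw [Finset.mul_sum, Finset.sum_eq_single i (fun j _ hji => h1 i j hji.symm) (by simp), hv]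
    · rw [← hq.sum_eq_one]
      refine Finset.sum_congr rfl fun i _ => ?_
      rw [Finset.mul_sum, Finset.sum_eq_single i (fun j _ hji => h2 i j hji.symm) (by simp), hv']
  · show (∑ i, v i) * (∑ i, lam i • p i) * star (∑ i, v i) = _
    have h3 : (∑ i, v i) * (∑ i, lam i • p i) = ∑ i, lam i • v i := by
      rw [Finset.sum_mul]
      refine Finset.sum_congr rfl fun i _ => ?_
      rw [Finset.mul_sum, Finset.sum_eq_single i, mul_smul_comm, hvp]
      · intro j _ hji
        rw [mul_smul_comm, hvpo i j hji.symm, smul_zero]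
      · simp
    rw [h3, star_sum, Finset.sum_mul]
    refine Finset.sum_congr rfl fun i _ => ?_
    rw [Finset.mul_sum, Finset.sum_eq_single i, smul_mul_assoc, hv']
    · intro j _ hji
      rw [smul_mul_assoc, h2 i j hji.symm, smul_zero]
    · simp

theorem isDiagonal_of_finite_spectrum {B : A} (hB : IsStarNormal B)
    (hfin : (spectrum ℂ B).Finite) :
    ∃ _ : Fintype (spectrum ℂ B), IsDiagonal (fun z : spectrum ℂ B => (z : ℂ)) B := by
  classical
  let : Fintype (spectrum ℂ B) := hfin.fintype
  have hcont : ∀ f : ℂ → ℂ, ContinuousOn f (spectrum ℂ B) := fun f => hfin.continuousOn f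
  set g : ℂ → ℂ → ℂ := fun z w => if w = z then 1 else 0 with hg
  refine ⟨inferInstance, fun z => cfc (g z) B, ⟨fun z => ⟨?_, ?_⟩, fun z h => ?_, ?_, ?_⟩, ?_⟩
  · show cfc (g z) B * cfc (g z) B = cfc (g z) B
    rw [← cfc_mul _ _ _ (hcont _) (hcont _)]
    exact cfc_congr fun w _ => by simp [hg]
  · show star (cfc (g z) B) = cfc (g z) B
    rw [← cfc_star]
    exact cfc_congr fun w _ => by simp only [hg]; split_ifs <;> simp
  · have := norm_apply_le_norm_cfc (g z) B z.2 (hcont _) hB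
    rw [h, norm_zero] at this
    simp only [hg, if_true, norm_one] at this
    linarith
  · intro z w hzw
    have hzw' : (z : ℂ) ≠ w := fun h => hzw (Subtype.ext h)
    show cfc (g z) B * cfc (g w) B = 0
    rw [← cfc_mul _ _ _ (hcont _) (hcont _), ← cfc_zero (R := ℂ) (a := B)]
    refine cfc_congr fun y _ => ?_
    simp only [hg]
    split_ifs with h1 h2
    · exact absurd (h1.symm.trans h2) hzw'
    all_goals simp
  · rw [← cfc_sum _ _ _ (fun _ _ => hcont _), ← cfc_one (R := ℂ) (a := B)]
    refine cfc_congr fun y hy => ?_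
    rw [Finset.sum_apply, Finset.sum_eq_single (⟨y, hy⟩ : spectrum ℂ B)]
    · simp [hg]
    · intro b _ hb
      exact if_neg fun h => hb (Subtype.ext h.symm)
    · simp
  · conv_lhs => rw [← cfc_id ℂ B]
    have : ∀ z : spectrum ℂ B, (z : ℂ) • cfc (g z) B = cfc (fun w => (z : ℂ) * g z w) B := fun z => by
      rw [cfc_const_mul _ _ _ (hcont _)]
    simp only [this]
    rw [← cfc_sum _ _ _ (fun _ _ => hcont _)]
    refine cfc_congr fun y hy => ?_
    rw [Finset.sum_apply, Finset.sum_eq_single (⟨y, hy⟩ : spectrum ℂ B)]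
    · simp [hg]
    · intro b _ hb
      simp [hg, show y ≠ (b : ℂ) from fun h => hb (Subtype.ext h.symm)]
    · simp

/-- The spectrum of a normal element moves by at most the size of the perturbation. -/
theorem exists_mem_spectrum_norm_sub_le {B N : A} (hB : IsStarNormal B) {z : ℂ}
    (hz : z ∈ spectrum ℂ N) : ∃ w ∈ spectrum ℂ B, ‖w - z‖ ≤ ‖N - B‖ := by
  by_contra! hcon
  rcases eq_or_ne N B with rfl | hne
  · simpa using hcon z hz
  have hpos : 0 < ‖N - B‖ := norm_pos_iff.2 (sub_ne_zero.2 hne)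
  have hw0 : ∀ w ∈ spectrum ℂ B, z - w ≠ 0 := fun w hw h => by
    have := hcon w hw
    rw [norm_sub_rev w, h, norm_zero] at this
    exact absurd this (not_lt.2 (norm_nonneg _))
  have hzB : z ∉ spectrum ℂ B := fun h => hw0 z h (sub_self z)
  obtain ⟨u, hu⟩ := spectrum.notMem_iff.1 hzB
  have hcw : ContinuousOn (fun w : ℂ => z - w) (spectrum ℂ B) := by fun_prop
  have hinv : ((u⁻¹ : Aˣ) : A) = cfc (fun w => (z - w)⁻¹) B := by
    rw [cfc_inv _ _ hw0 hcw, cfc_sub _ _ _, cfc_const z B, cfc_id' ℂ B, ← hu, Ring.inverse_unit]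
  have hlt : ‖((u⁻¹ : Aˣ) : A)‖ < ‖N - B‖⁻¹ := by
    rw [hinv]
    refine norm_cfc_lt (inv_pos.2 hpos) fun w hw => ?_
    rw [norm_inv]
    refine inv_strictAnti₀ hpos ?_
    rw [norm_sub_rev z]
    exact hcon w hw
  have : Nontrivial A := ⟨⟨N, B, hne⟩⟩
  have hnear : ‖(algebraMap ℂ A z - N) - u‖ < ‖((u⁻¹ : Aˣ) : A)‖⁻¹ := by
    rw [hu, sub_sub_sub_cancel_left, ← norm_neg, neg_sub]
    exact (lt_inv_comm₀ (Units.norm_pos _) hpos).1 hlt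
  exact hz ⟨u.ofNearby _ hnear, rfl⟩

end Diagonal

/-! ### Limits of diagonal elements -/

section DiagonalLimit

/-- `a` is a limit of diagonal elements whose sets of eigenvalues converge to `K`. For compact
`K`, such an element is determined by `K` up to approximate unitary equivalence. -/
def IsDiagonalLimit {A : Type*} [CStarAlgebra A] (K : Set ℂ) (a : A) : Prop :=
  ∀ ε : ℝ, 0 < ε → ∃ (ι : Type) (_ : Fintype ι) (lam : ι → ℂ) (d : A), IsDiagonal lam d ∧
    ‖a - d‖ ≤ ε ∧ (∀ i, ∃ z ∈ K, ‖lam i - z‖ ≤ ε) ∧ ∀ z ∈ K, ∃ i, ‖lam i - z‖ ≤ ε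

variable {A : Type*} [CStarAlgebra A]

theorem norm_unitary_conj (u : unitary A) (a : A) : ‖(u : A) * a * star (u : A)‖ = ‖a‖ := by
  rw [← Unitary.coe_star, CStarRing.norm_mul_coe_unitary, CStarRing.norm_coe_unitary_mul]

theorem IsDiagonal.isDiagonalLimit {ι : Type} [Fintype ι] {lam : ι → ℂ} {a : A}
    (ha : IsDiagonal lam a) : IsDiagonalLimit (Set.range lam) a := fun ε hε =>
  ⟨ι, inferInstance, lam, a, ha, by simpa using hε.le,
    fun i => ⟨lam i, ⟨i, rfl⟩, by simpa using hε.le⟩,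
    fun _ ⟨i, hi⟩ => ⟨i, by simpa [hi] using hε.le⟩⟩

theorem isDiagonalLimit_spectrum (hFN : WeakFN A) {N : A} (hN : IsStarNormal N)
    (hN0 : ResolventInIdentityComponent N) : IsDiagonalLimit (spectrum ℂ N) N := by
  intro ε hε
  obtain ⟨B, ⟨hB, hfin⟩, hNB⟩ := Metric.mem_closure_iff.1 (hFN N hN hN0) ε hε
  rw [dist_eq_norm] at hNB
  obtain ⟨_, hd⟩ := isDiagonal_of_finite_spectrum hB hfin
  refine ⟨_, _, _, B, hd, hNB.le, fun i => ?_, fun z hz => ?_⟩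
  · obtain ⟨w, hw, hwi⟩ := exists_mem_spectrum_norm_sub_le (B := N) hN i.2
    refine ⟨w, hw, ?_⟩
    rw [norm_sub_rev]
    rw [norm_sub_rev] at hNB
    exact hwi.trans hNB.le
  · obtain ⟨w, hw, hwz⟩ := exists_mem_spectrum_norm_sub_le (B := B) hB hz
    exact ⟨⟨w, hw⟩, hwz.trans hNB.le⟩

theorem IsProjectionPartition.unitary_conj {ι : Type*} [Fintype ι] {p : ι → A}
    (hp : IsProjectionPartition p) (u : unitary A) :
    IsProjectionPartition fun i => (u : A) * p i * star (u : A) := by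
  have hu : star (u : A) * u = 1 := Unitary.coe_star_mul_self u
  have hmul : ∀ x y : A, (u : A) * x * star (u : A) * (u * y * star (u : A)) =
      u * (x * y) * star (u : A) := fun x y => by
    calc (u : A) * x * star (u : A) * (u * y * star (u : A))
        = u * x * (star (u : A) * u) * y * star (u : A) := by noncomm_ring
      _ = u * (x * y) * star (u : A) := by rw [hu, mul_one, mul_assoc (u : A)]
  refine ⟨fun i => ⟨?_, ?_⟩, fun i h => hp.ne_zero i ?_, fun i j hij => ?_, ?_⟩
  · show _ * _ = _
    rw [hmul, (hp.proj i).isIdempotentElem.eq]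
  · show star _ = _
    rw [star_mul, star_mul, star_star, (hp.proj i).isSelfAdjoint.star_eq, mul_assoc]
  · rw [← norm_eq_zero, ← norm_unitary_conj u, norm_eq_zero]
    exact h
  · rw [hmul, hp.orthogonal i j hij, mul_zero, zero_mul]
  · rw [← Finset.sum_mul, ← Finset.mul_sum, hp.sum_eq_one, mul_one]
    exact Unitary.coe_mul_star_self u

theorem IsDiagonal.unitary_conj {ι : Type*} [Fintype ι] {lam : ι → ℂ} {a : A}
    (ha : IsDiagonal lam a) (u : unitary A) : IsDiagonal lam ((u : A) * a * star (u : A)) := by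
  obtain ⟨p, hp, rfl⟩ := ha
  refine ⟨_, hp.unitary_conj u, ?_⟩
  simp only [Finset.mul_sum, Finset.sum_mul, mul_smul_comm, smul_mul_assoc]

/-- A common refinement of two diagonal elements pairs off nearby eigenvalues. -/
theorem IsDiagonalLimit.exists_isDiagonal (hA : HasInterchangeableProjections A) {K : Set ℂ}
    {a : A} (ha : IsDiagonalLimit K a) {ι : Type} [Fintype ι] {lam : ι → ℂ} {C : ℝ} (hC : 0 ≤ C)
    (h1 : ∀ i, ∃ z ∈ K, ‖lam i - z‖ ≤ C) (h2 : ∀ z ∈ K, ∃ i, ‖lam i - z‖ ≤ C) {ε : ℝ}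
    (hε : 0 < ε) : ∃ d : A, IsDiagonal lam d ∧ ‖a - d‖ ≤ C + ε := by
  classical
  rcases subsingleton_or_nontrivial A with hs | hs
  · obtain ⟨κ, _, μ, d, ⟨p, hp, rfl⟩, -, hκ, hκ'⟩ := ha ε hε
    have hιe : IsEmpty ι := ⟨fun i => by
      obtain ⟨z, hz, -⟩ := h1 i
      obtain ⟨k, -⟩ := hκ' z hz
      exact hp.ne_zero k (Subsingleton.elim _ _)⟩
    exact ⟨0, ⟨fun _ => 0, ⟨fun i => hιe.elim i, fun i => hιe.elim i, fun i => hιe.elim i,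
      Subsingleton.elim _ _⟩, Subsingleton.elim _ _⟩, by
        rw [Subsingleton.elim (a - 0) 0, norm_zero]; positivity⟩
  obtain ⟨κ, _, μ, d0, hd0, had0, hκ, hκ'⟩ := ha (ε / 2) (half_pos hε)
  let Z := {x : ι × κ // ‖lam x.1 - μ x.2‖ ≤ C + ε / 2}
  have hf : Function.Surjective fun x : Z => x.1.2 := fun k => by
    obtain ⟨z, hz, hkz⟩ := hκ k
    obtain ⟨i, hi⟩ := h2 z hz
    refine ⟨⟨(i, k), ?_⟩, rfl⟩
    calc ‖lam i - μ k‖ ≤ ‖lam i - z‖ + ‖z - μ k‖ := norm_sub_le_norm_sub_add_norm_sub _ _ _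
      _ ≤ _ := add_le_add hi (by rwa [norm_sub_rev])
  have hg : Function.Surjective fun x : Z => x.1.1 := fun i => by
    obtain ⟨z, hz, hiz⟩ := h1 i
    obtain ⟨k, hk⟩ := hκ' z hz
    refine ⟨⟨(i, k), ?_⟩, rfl⟩
    calc ‖lam i - μ k‖ ≤ ‖lam i - z‖ + ‖z - μ k‖ := norm_sub_le_norm_sub_add_norm_sub _ _ _
      _ ≤ _ := add_le_add hiz (by rwa [norm_sub_rev])
  obtain ⟨d, hd, hd0d⟩ := (hd0.comp_surjective hA hf).exists_near
    (lam' := lam ∘ fun x : Z => x.1.1) (C := C + ε / 2) (by positivity)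
    fun x => by rw [norm_sub_rev]; exact x.2
  have hκne : Nonempty κ := by
    by_contra hn
    rw [not_nonempty_iff] at hn
    obtain ⟨p, hp, -⟩ := hd0
    have := hp.sum_eq_one
    simp at this
  obtain ⟨k0⟩ := hκne
  have : Nonempty ι := ⟨(hf k0).choose.1.1⟩
  obtain ⟨d1, hd1⟩ := hA.exists_isDiagonal lam
  obtain ⟨u, hu⟩ := (hd1.comp_surjective hA hg).exists_unitary_conj hA hd
  refine ⟨d, hu ▸ hd1.unitary_conj u, ?_⟩
  calc ‖a - d‖ ≤ ‖a - d0‖ + ‖d0 - d‖ := norm_sub_le_norm_sub_add_norm_sub _ _ _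
    _ ≤ ε / 2 + (C + ε / 2) := add_le_add had0 hd0d
    _ = C + ε := by ring

theorem IsDiagonalLimit.exists_unitary_conj_near (hA : HasInterchangeableProjections A)
    {K K' : Set ℂ} {a b : A} (ha : IsDiagonalLimit K a) (hb : IsDiagonalLimit K' b) {C : ℝ}
    (hC : 0 ≤ C) (h1 : ∀ w ∈ K', ∃ z ∈ K, ‖w - z‖ ≤ C) (h2 : ∀ z ∈ K, ∃ w ∈ K', ‖w - z‖ ≤ C)
    {ε : ℝ} (hε : 0 < ε) : ∃ u : unitary A, ‖(u : A) * a * star (u : A) - b‖ ≤ C + ε := by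
  obtain ⟨κ, _, μ, d, hd, hbd, hκ, hκ'⟩ := hb (ε / 3) (by positivity)
  obtain ⟨d', hd', had'⟩ := ha.exists_isDiagonal hA (lam := μ) (C := C + ε / 3) (by positivity)
    (fun k => by
      obtain ⟨w, hw, hkw⟩ := hκ k
      obtain ⟨z, hz, hwz⟩ := h1 w hw
      refine ⟨z, hz, ?_⟩
      linarith [norm_sub_le_norm_sub_add_norm_sub (μ k) w z])
    (fun z hz => by
      obtain ⟨w, hw, hwz⟩ := h2 z hz
      obtain ⟨k, hk⟩ := hκ' w hw
      refine ⟨k, ?_⟩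
      linarith [norm_sub_le_norm_sub_add_norm_sub (μ k) w z]) (ε := ε / 3) (by positivity)
  obtain ⟨u, hu⟩ := hd'.exists_unitary_conj hA hd
  refine ⟨u, ?_⟩
  have h3 : (u : A) * a * star (u : A) - b =
      (u : A) * (a - d') * star (u : A) - (b - d) := by
    rw [mul_sub, sub_mul, hu]
    abel
  rw [h3]
  refine (norm_sub_le _ _).trans ?_
  rw [norm_unitary_conj]
  linarith

theorem exists_isDiagonalLimit [Nontrivial A] (hA : HasInterchangeableProjections A) {K : Set ℂ}
    (hK : IsCompact K) (hne : K.Nonempty) : ∃ a : A, IsDiagonalLimit K a := by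
  have hnet : ∀ n : ℕ, ∃ t : Finset ℂ, (∀ w ∈ t, w ∈ K) ∧
      ∀ z ∈ K, ∃ w ∈ t, ‖w - z‖ ≤ (1 / 2 : ℝ) ^ n := fun n => by
    obtain ⟨t, htK, hfin, ht⟩ := hK.finite_cover_balls (e := (1 / 2 : ℝ) ^ n) (by positivity)
    refine ⟨hfin.toFinset, fun w hw => htK (hfin.mem_toFinset.1 hw), fun z hz => ?_⟩
    obtain ⟨w, hw, hzw⟩ := Set.mem_iUnion₂.1 (ht hz)
    refine ⟨w, hfin.mem_toFinset.2 hw, ?_⟩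
    rw [Metric.mem_ball, dist_comm, dist_eq_norm] at hzw
    exact hzw.le
  choose t htK ht using hnet
  have : ∀ n, Nonempty (t n) := fun n => by
    obtain ⟨z, hz⟩ := hne
    obtain ⟨w, hw, -⟩ := ht n z hz
    exact ⟨⟨w, hw⟩⟩
  have hstep : ∀ n (a : A), IsDiagonal (fun w : t n => (w : ℂ)) a →
      ∃ b : A, IsDiagonal (fun w : t (n + 1) => (w : ℂ)) b ∧ ‖a - b‖ ≤ 2 * (1 / 2 : ℝ) ^ n := by
    intro n a ha
    have hpos : (0 : ℝ) < (1 / 2 : ℝ) ^ n := by positivity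
    obtain ⟨b, hb, hab⟩ := ha.isDiagonalLimit.exists_isDiagonal hA
      (lam := fun w : t (n + 1) => (w : ℂ)) (C := (1 / 2 : ℝ) ^ n) hpos.le
      (fun w => by
        obtain ⟨z, hz, hwz⟩ := ht n w (htK _ w w.2)
        exact ⟨z, ⟨⟨z, hz⟩, rfl⟩, by rwa [norm_sub_rev]⟩)
      (by
        rintro _ ⟨z, rfl⟩
        obtain ⟨w, hw, hwz⟩ := ht (n + 1) z (htK _ z z.2)
        refine ⟨⟨w, hw⟩, hwz.trans ?_⟩
        rw [pow_succ]
        linarith) hpos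
    exact ⟨b, hb, by linarith⟩
  obtain ⟨a0, ha0⟩ := hA.exists_isDiagonal fun w : t 0 => (w : ℂ)
  choose! next hnext hdist using hstep
  let s : ℕ → A := fun n => Nat.rec a0 (fun n a => next n a) n
  have hs : ∀ n, IsDiagonal (fun w : t n => (w : ℂ)) (s n) := fun n => by
    induction n with
    | zero => exact ha0
    | succ n ih => exact hnext n _ ih
  have hsd : ∀ n, dist (s n) (s (n + 1)) ≤ 2 * (1 / 2 : ℝ) ^ n := fun n => by
    rw [dist_eq_norm]
    exact hdist n _ (hs n)
  obtain ⟨a, ha⟩ := cauchySeq_tendsto_of_complete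
    (cauchySeq_of_le_geometric (1 / 2) 2 (by norm_num) hsd)
  refine ⟨a, fun ε hε => ?_⟩
  obtain ⟨n, hn⟩ := exists_pow_lt_of_lt_one (show 0 < ε / 4 by positivity)
    (show (1 / 2 : ℝ) < 1 by norm_num)
  refine ⟨t n, inferInstance, _, s n, hs n, ?_, fun w => ⟨w, htK n w w.2, by simpa using hε.le⟩,
    fun z hz => ?_⟩
  · have := dist_le_of_le_geometric_of_tendsto (1 / 2) 2 (by norm_num) hsd ha n
    rw [← dist_eq_norm, dist_comm]
    norm_num at this hn ⊢
    linarith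
  · obtain ⟨w, hw, hwz⟩ := ht n z hz
    exact ⟨⟨w, hw⟩, hwz.trans (by linarith)⟩

end DiagonalLimit

/-! ### Hilbert's inequality -/

section HilbertMatrix

open Complex in
theorem integral_exp_int_mul (m : ℤ) :
    ∫ θ in (0 : ℝ)..2 * Real.pi, exp (I * m * θ) = if m = 0 then 2 * (Real.pi : ℂ) else 0 := by
  split_ifs with hm
  · simp [hm]
  · have hc : I * (m : ℂ) ≠ 0 := mul_ne_zero I_ne_zero (by exact_mod_cast hm)
    rw [integral_exp_mul_complex hc]
    have : I * m * ((2 * Real.pi : ℝ) : ℂ) = m * (2 * Real.pi * I) := by push_cast; ring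
    rw [this, exp_int_mul_two_pi_mul_I]
    simp

open Complex in
/-- The Fourier coefficients of the sawtooth function. At `m = 0` both sides vanish. -/
theorem integral_sawtooth_mul_exp (m : ℤ) :
    ∫ θ in (0 : ℝ)..2 * Real.pi, ((Real.pi - θ : ℝ) : ℂ) * exp (I * m * θ) =
      2 * Real.pi * I * (m : ℂ)⁻¹ := by
  rcases eq_or_ne m 0 with rfl | hm
  · have : ∫ θ in (0 : ℝ)..2 * Real.pi, (Real.pi - θ) = 0 := by
      rw [intervalIntegral.integral_sub (by simp) (by simp)]
      simp
      ring
    simp only [Int.cast_zero, mul_zero, zero_mul, exp_zero, mul_one, inv_zero]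
    rw [intervalIntegral.integral_ofReal, this, ofReal_zero]
  · set c : ℂ := I * m with hcdef
    have hc : c ≠ 0 := mul_ne_zero I_ne_zero (by exact_mod_cast hm)
    have hderiv : ∀ θ : ℝ, HasDerivAt
        (fun θ : ℝ => ((Real.pi - θ : ℝ) : ℂ) * exp (c * θ) / c + exp (c * θ) / c ^ 2)
        (((Real.pi - θ : ℝ) : ℂ) * exp (c * θ)) θ := fun θ => by
      have h1 : HasDerivAt (fun θ : ℝ => exp (c * θ)) (exp (c * θ) * c) θ := by
        simpa using ((ofRealCLM.hasDerivAt (x := θ)).const_mul c).cexp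
      have h2 : HasDerivAt (fun θ : ℝ => ((Real.pi - θ : ℝ) : ℂ)) (-1) θ := by
        simpa using ((hasDerivAt_id θ).const_sub Real.pi).ofReal_comp
      convert! ((h2.mul h1).div_const c).add (h1.div_const (c ^ 2)) using 1
      field_simp
      ring
    rw [intervalIntegral.integral_eq_sub_of_hasDerivAt (fun θ _ => hderiv θ)
      (Continuous.intervalIntegrable (by fun_prop) _ _)]
    have : c * ((2 * Real.pi : ℝ) : ℂ) = m * (2 * Real.pi * I) := by
      rw [hcdef]; push_cast; ring
    rw [this, exp_int_mul_two_pi_mul_I]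
    simp only [ofReal_zero, mul_zero, exp_zero, hcdef]
    have hm' : (m : ℂ) ≠ 0 := by exact_mod_cast hm
    push_cast
    field_simp
    ring_nf
    simp

open Complex in
/-- Hilbert's inequality: the form with coefficients `1 / (j - i)` is the sawtooth function,
bounded by `π`, integrated against `|∑ x j exp (i j θ)|²`. -/
theorem norm_hilbert_form_le {n : ℕ} (x : Fin n → ℂ) :
    ‖∑ i, ∑ j, (starRingEnd ℂ) (x i) * x j * ((j : ℂ) - (i : ℂ))⁻¹‖ ≤
      Real.pi * ∑ i, ‖x i‖ ^ 2 := by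
  set f : ℝ → ℂ := fun θ => ∑ j, x j * exp (I * (j : ℕ) * θ) with hf
  have hexp : ∀ θ : ℝ, (‖f θ‖ ^ 2 : ℝ) =
      ∑ i, ∑ j, (starRingEnd ℂ) (x i) * x j * exp (I * (((j : ℕ) : ℤ) - ((i : ℕ) : ℤ) : ℤ) * θ) :=
    fun θ => by
      rw [ofReal_pow, ← conj_mul', hf]
      simp only [map_sum, map_mul, Finset.sum_mul_sum]
      refine Finset.sum_congr rfl fun i _ => Finset.sum_congr rfl fun j _ => ?_
      rw [← exp_conj]
      simp only [map_mul, conj_I, conj_ofReal, map_natCast]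
      have : exp (I * (((j : ℕ) : ℤ) - ((i : ℕ) : ℤ) : ℤ) * θ) =
          exp (-I * (i : ℕ) * θ) * exp (I * (j : ℕ) * θ) := by
        rw [← exp_add]
        congr 1
        push_cast
        ring
      rw [this]
      ring
  have hfc : Continuous f := by simp only [hf]; fun_prop
  have h1 : ∫ θ in (0 : ℝ)..2 * Real.pi, ((‖f θ‖ ^ 2 : ℝ) : ℂ) =
      2 * Real.pi * ∑ i, (‖x i‖ ^ 2 : ℝ) := by
    simp only [hexp]
    rw [intervalIntegral.integral_finsetSum
      fun i _ => Continuous.intervalIntegrable (by fun_prop) _ _, ofReal_sum, Finset.mul_sum]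
    refine Finset.sum_congr rfl fun i _ => ?_
    rw [intervalIntegral.integral_finsetSum
      fun j _ => Continuous.intervalIntegrable (by fun_prop) _ _, Finset.sum_eq_single i]
    · rw [intervalIntegral.integral_const_mul, integral_exp_int_mul, if_pos (sub_self _),
        conj_mul', ofReal_pow]
      ring
    · intro j _ hji
      rw [intervalIntegral.integral_const_mul, integral_exp_int_mul, if_neg, mul_zero]
      intro h
      exact hji (Fin.ext (by exact_mod_cast sub_eq_zero.1 h))
    · simp
  have h2 : ∫ θ in (0 : ℝ)..2 * Real.pi, ((Real.pi - θ : ℝ) : ℂ) * ((‖f θ‖ ^ 2 : ℝ) : ℂ) =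
      2 * Real.pi * I * ∑ i, ∑ j, (starRingEnd ℂ) (x i) * x j * ((j : ℂ) - (i : ℂ))⁻¹ := by
    simp only [hexp, Finset.mul_sum]
    rw [intervalIntegral.integral_finsetSum
      fun i _ => Continuous.intervalIntegrable (by fun_prop) _ _]
    refine Finset.sum_congr rfl fun i _ => ?_
    rw [intervalIntegral.integral_finsetSum
      fun j _ => Continuous.intervalIntegrable (by fun_prop) _ _]
    refine Finset.sum_congr rfl fun j _ => ?_
    have := integral_sawtooth_mul_exp (((j : ℕ) : ℤ) - ((i : ℕ) : ℤ))
    calc _ = ∫ θ in (0 : ℝ)..2 * Real.pi, (starRingEnd ℂ) (x i) * x j *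
          (((Real.pi - θ : ℝ) : ℂ) * exp (I * (((j : ℕ) : ℤ) - ((i : ℕ) : ℤ) : ℤ) * θ)) := by
          refine intervalIntegral.integral_congr fun θ _ => ?_
          ring
      _ = _ := by
          rw [intervalIntegral.integral_const_mul, this]
          push_cast
          ring
  have h1' : ∫ θ in (0 : ℝ)..2 * Real.pi, ‖f θ‖ ^ 2 = 2 * Real.pi * ∑ i, ‖x i‖ ^ 2 := by
    rw [intervalIntegral.integral_ofReal] at h1
    exact_mod_cast h1
  have h3 : ‖∫ θ in (0 : ℝ)..2 * Real.pi, ((Real.pi - θ : ℝ) : ℂ) * ((‖f θ‖ ^ 2 : ℝ) : ℂ)‖ ≤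
      ∫ θ in (0 : ℝ)..2 * Real.pi, Real.pi * ‖f θ‖ ^ 2 := by
    refine intervalIntegral.norm_integral_le_of_norm_le (by positivity) ?_
      (Continuous.intervalIntegrable (by fun_prop) _ _)
    refine Filter.Eventually.of_forall fun θ hθ => ?_
    rw [norm_mul, norm_real, norm_real, Real.norm_of_nonneg (sq_nonneg ‖f θ‖)]
    refine mul_le_mul_of_nonneg_right ?_ (sq_nonneg _)
    rw [Real.norm_eq_abs, abs_le]
    constructor <;> linarith [hθ.1, hθ.2]
  rw [h2, intervalIntegral.integral_const_mul, h1', norm_mul] at h3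
  have h4 : ‖(2 * Real.pi * I : ℂ)‖ = 2 * Real.pi := by
    simp [abs_of_pos Real.pi_pos]
  rw [h4] at h3
  have h5 : 0 < 2 * Real.pi := by positivity
  refine le_of_mul_le_mul_left (h3.trans (le_of_eq ?_)) h5
  ring

end HilbertMatrix

/-! ### Unboundedness of triangular truncation -/

section TriangularTruncation

open scoped Matrix.Norms.L2Operator

open Matrix in
theorem Matrix.IsHermitian.norm_eq_norm_eigenvalues {n : Type*} [Fintype n] [DecidableEq n]
    {B : Matrix n n ℂ} (hB : B.IsHermitian) : ‖B‖ = ‖hB.eigenvalues‖ := by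
  conv_lhs => rw [hB.spectral_theorem]
  rw [Unitary.conjStarAlgAut_apply, ← Unitary.coe_star, CStarRing.norm_mul_coe_unitary,
    CStarRing.norm_coe_unitary_mul, l2_opNorm_diagonal]
  simp [Pi.norm_def]

open Matrix in
theorem Matrix.IsHermitian.norm_le_of_form_le {n : Type*} [Fintype n] [DecidableEq n]
    {B : Matrix n n ℂ} (hB : B.IsHermitian) {C : ℝ} (hC : 0 ≤ C)
    (h : ∀ x : n → ℂ, ‖star x ⬝ᵥ (B *ᵥ x)‖ ≤ C * ∑ i, ‖x i‖ ^ 2) : ‖B‖ ≤ C := by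
  rw [hB.norm_eq_norm_eigenvalues, pi_norm_le_iff_of_nonneg hC]
  intro i
  have h1 := h (hB.eigenvectorBasis i)
  rw [← EuclideanSpace.norm_sq_eq, hB.eigenvectorBasis.orthonormal.1 i] at h1
  rw [hB.eigenvalues_eq i]
  refine (Complex.abs_re_le_norm _).trans ?_
  simpa using h1

open Matrix in
/-- The strictly upper triangular Toeplitz matrix with entries `1 / (j - i)`. -/
noncomputable def upperHilbertMatrix (n : ℕ) : Matrix (Fin n) (Fin n) ℂ :=
  Matrix.of fun i j => if i < j then ((j : ℂ) - (i : ℂ))⁻¹ else 0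

open Matrix in
theorem norm_upperHilbertMatrix_sub_le (n : ℕ) :
    ‖upperHilbertMatrix n - (upperHilbertMatrix n)ᴴ‖ ≤ Real.pi := by
  set B := upperHilbertMatrix n - (upperHilbertMatrix n)ᴴ with hBdef
  have hB : ∀ i j, B i j = ((j : ℂ) - (i : ℂ))⁻¹ := fun i j => by
    simp only [hBdef, Matrix.sub_apply, conjTranspose_apply, upperHilbertMatrix, of_apply]
    rcases lt_trichotomy i j with h | h | h
    · simp [h, h.not_gt]
    · simp [h]
    · rw [if_neg h.not_gt, if_pos h]
      simp only [RCLike.star_def, map_inv₀, map_sub, map_natCast]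
      rw [zero_sub, ← inv_neg, neg_sub]
  have hherm : (Complex.I • B).IsHermitian := by
    rw [IsHermitian, conjTranspose_smul, hBdef, conjTranspose_sub, conjTranspose_conjTranspose]
    simp only [RCLike.star_def, Complex.conj_I]
    rw [neg_smul, ← smul_neg, neg_sub]
  have h1 : ‖Complex.I • B‖ ≤ Real.pi := by
    refine hherm.norm_le_of_form_le Real.pi_pos.le fun x => ?_
    refine le_trans (le_of_eq ?_) (norm_hilbert_form_le x)
    rw [smul_mulVec, dotProduct_smul, norm_smul, Complex.norm_I, one_mul]
    congr 1
    simp only [dotProduct, mulVec, Pi.star_apply, RCLike.star_def, Finset.mul_sum, hB]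
    refine Finset.sum_congr rfl fun i _ => Finset.sum_congr rfl fun j _ => ?_
    ring
  rwa [norm_smul, Complex.norm_I, one_mul] at h1

open Matrix in
theorem norm_sum_entries_le {n : ℕ} (B : Matrix (Fin n) (Fin n) ℂ) :
    ‖∑ i, ∑ j, B i j‖ ≤ n * ‖B‖ := by
  set x : EuclideanSpace ℂ (Fin n) := WithLp.toLp 2 fun _ => 1 with hx
  have hxn : ‖x‖ ^ 2 = n := by
    rw [EuclideanSpace.norm_sq_eq]
    simp [hx]
  have h1 : ∑ i, ∑ j, B i j = inner ℂ x (WithLp.toLp 2 (B *ᵥ x.ofLp)) := by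
    simp [hx, PiLp.inner_apply, mulVec, dotProduct]
  rw [h1]
  refine (norm_inner_le_norm _ _).trans ?_
  have h2 := l2_opNorm_mulVec B x
  calc ‖x‖ * ‖WithLp.toLp 2 (B *ᵥ x.ofLp)‖ ≤ ‖x‖ * (‖B‖ * ‖x‖) :=
        mul_le_mul_of_nonneg_left h2 (norm_nonneg _)
    _ = ‖x‖ ^ 2 * ‖B‖ := by ring
    _ = n * ‖B‖ := by rw [hxn]

open Matrix in
/-- Testing against the constant vector: the norm grows at least like the harmonic sums. -/
theorem harmonic_le_norm_upperHilbertMatrix_add (m : ℕ) (hm : 0 < m) :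
    ∑ k ∈ Finset.range m, 1 / ((k : ℝ) + 1) ≤
      ‖upperHilbertMatrix (2 * m) + (upperHilbertMatrix (2 * m))ᴴ‖ := by
  set L := upperHilbertMatrix (2 * m) with hL
  set S : ℝ := ∑ k ∈ Finset.range m, 1 / ((k : ℝ) + 1) with hS
  have hS0 : 0 ≤ S := Finset.sum_nonneg fun k _ => by positivity
  have hsum : ∑ i, ∑ j, L i j =
      ((∑ j ∈ Finset.range (2 * m), ∑ k ∈ Finset.range j, 1 / ((k : ℝ) + 1) : ℝ) : ℂ) := by
    refine (Finset.sum_comm (f := fun i j => L i j)).trans ?_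
    rw [Complex.ofReal_sum, Finset.sum_range]
    refine Finset.sum_congr rfl fun j _ => ?_
    have h1 : ∑ i : Fin (2 * m), L i j = ∑ i ∈ Finset.range (2 * m),
        if i < (j : ℕ) then (((j : ℕ) : ℂ) - (i : ℂ))⁻¹ else 0 := by
      rw [Finset.sum_range]
      rfl
    rw [h1, ← Finset.sum_filter]
    have h2 : (Finset.range (2 * m)).filter (fun i => i < (j : ℕ)) = Finset.range j := by
      ext i
      simp only [Finset.mem_filter, Finset.mem_range]
      have := j.2
      omega
    rw [h2, ← Finset.sum_range_reflect, Complex.ofReal_sum]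
    refine Finset.sum_congr rfl fun i hi => ?_
    have hi' : i < j := Finset.mem_range.1 hi
    rw [Nat.sub_sub, Nat.cast_sub (by omega)]
    push_cast
    rw [one_div]
    congr 1
    ring
  have hsum' : ∑ i, ∑ j, Lᴴ i j = ∑ i, ∑ j, L i j := by
    have : ∑ i, ∑ j, Lᴴ i j = star (∑ i, ∑ j, L i j) := by
      refine (Finset.sum_comm (f := fun i j => Lᴴ i j)).trans ?_
      simp [star_sum, conjTranspose_apply]
    rw [this, hsum]
    simp
  have hlow : m * S ≤ ∑ j ∈ Finset.range (2 * m), ∑ k ∈ Finset.range j, 1 / ((k : ℝ) + 1) := by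
    calc m * S = ∑ j ∈ Finset.Ico m (2 * m), S := by
          rw [Finset.sum_const, Nat.card_Ico, nsmul_eq_mul]
          congr 2
          omega
      _ ≤ ∑ j ∈ Finset.Ico m (2 * m), ∑ k ∈ Finset.range j, 1 / ((k : ℝ) + 1) := by
          refine Finset.sum_le_sum fun j hj => ?_
          exact Finset.sum_le_sum_of_subset_of_nonneg
            (Finset.range_mono (Finset.mem_Ico.1 hj).1) fun k _ _ => by positivity
      _ ≤ _ := by
          refine Finset.sum_le_sum_of_subset_of_nonneg (fun j hj => ?_)
            fun j _ _ => Finset.sum_nonneg fun k _ => by positivity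
          exact Finset.mem_range.2 (Finset.mem_Ico.1 hj).2
  have h3 := norm_sum_entries_le (L + Lᴴ)
  simp only [Matrix.add_apply, Finset.sum_add_distrib] at h3
  rw [hsum', hsum, ← Complex.ofReal_add, Complex.norm_real] at h3
  have h4 := (le_abs_self _).trans h3
  push_cast at h4
  have hm' : (0 : ℝ) < m := by exact_mod_cast hm
  nlinarith

open Matrix in
/-- Triangular truncation is unbounded: a strictly upper triangular matrix can have a small
imaginary part compared to its real part. -/
theorem exists_strictUpper_norm_sub_le {ε : ℝ} (hε : 0 < ε) :
    ∃ (n : ℕ) (Q : Matrix (Fin n) (Fin n) ℂ), (∀ i j, j ≤ i → Q i j = 0) ∧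
      ‖Q - Qᴴ‖ ≤ ε ∧ ‖Q + Qᴴ‖ = 2 := by
  obtain ⟨m, hm1, hm⟩ := ((Filter.tendsto_atTop.1 Real.tendsto_sum_range_one_div_nat_succ_atTop
    (2 * Real.pi / ε)).and (Filter.eventually_gt_atTop 0)).exists
  set L := upperHilbertMatrix (2 * m) with hL
  have hlow := hm1.trans (harmonic_le_norm_upperHilbertMatrix_add m hm)
  set s := ‖L + Lᴴ‖ with hs
  have hs0 : 0 < s := lt_of_lt_of_le (by positivity) hlow
  have hreal : (((2 / s : ℝ) : ℂ) • L)ᴴ = ((2 / s : ℝ) : ℂ) • Lᴴ := by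
    rw [conjTranspose_smul]
    simp
  have hnorm : ‖((2 / s : ℝ) : ℂ)‖ = 2 / s := by
    rw [Complex.norm_real, Real.norm_of_nonneg (by positivity)]
  refine ⟨2 * m, ((2 / s : ℝ) : ℂ) • L, fun i j hij => ?_, ?_, ?_⟩
  · simp [hL, upperHilbertMatrix, hij.not_gt]
  · rw [hreal, ← smul_sub, norm_smul, hnorm]
    calc 2 / s * ‖L - Lᴴ‖ ≤ 2 / s * Real.pi :=
          mul_le_mul_of_nonneg_left (norm_upperHilbertMatrix_sub_le _) (by positivity)
      _ ≤ ε := by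
          rw [div_mul_eq_mul_div, div_le_iff₀ hs0]
          rwa [div_le_iff₀ hε, mul_comm s] at hlow
  · rw [hreal, ← smul_add, norm_smul, hnorm, ← hs]
    field_simp

end TriangularTruncation

/-! ### Strictly upper triangular matrices near hermitian matrices -/

section BlockSum

open scoped Matrix.Norms.L2Operator Kronecker

open Matrix in
/-- Amplification `B ↦ 1 ⊗ B` with the index pairs relabelled by `Fin (m * n)`. -/
noncomputable def amplificationHom (m n : ℕ) :
    Matrix (Fin n) (Fin n) ℂ →⋆ₙₐ[ℂ] Matrix (Fin (m * n)) (Fin (m * n)) ℂ where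
  toFun B := ((1 : Matrix (Fin m) (Fin m) ℂ) ⊗ₖ B).submatrix finProdFinEquiv.symm
    finProdFinEquiv.symm
  map_smul' r B := by rw [kronecker_smul]; rfl
  map_zero' := by rw [kronecker_zero]; rfl
  map_add' B C := by rw [kronecker_add]; rfl
  map_mul' B C := by rw [submatrix_mul_equiv, ← mul_kronecker_mul, one_mul]
  map_star' B := by
    rw [star_eq_conjTranspose, star_eq_conjTranspose, conjTranspose_submatrix,
      conjTranspose_kronecker, conjTranspose_one]

open Matrix in
theorem amplificationHom_apply (m n : ℕ) (B : Matrix (Fin n) (Fin n) ℂ) (a a' : Fin m)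
    (b b' : Fin n) : amplificationHom m n B (finProdFinEquiv (a, b)) (finProdFinEquiv (a', b')) =
      if a = a' then B b b' else 0 := by
  show (((1 : Matrix (Fin m) (Fin m) ℂ) ⊗ₖ B).submatrix finProdFinEquiv.symm
    finProdFinEquiv.symm) _ _ = _
  rw [submatrix_apply, Equiv.symm_apply_apply, Equiv.symm_apply_apply, kroneckerMap_apply,
    one_apply, ite_mul, one_mul, zero_mul]

open Matrix in
/-- Strictly upper triangular matrices come arbitrarily close to hermitian matrices of norm at
most `1` whose eigenvalues are as dense in `[-1, 1]` as desired: sum up multiples of one matrix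
with small imaginary part. -/
theorem exists_strictUpper_near_hermitian {ε : ℝ} (hε : 0 < ε) :
    ∃ (n : ℕ) (Q U : Matrix (Fin n) (Fin n) ℂ) (h : Fin n → ℝ), (∀ i j, j ≤ i → Q i j = 0) ∧
      U ∈ unitary (Matrix (Fin n) (Fin n) ℂ) ∧ (∀ j, |h j| ≤ 1) ∧
      (∀ t : ℝ, |t| ≤ 1 → ∃ j, |h j - t| ≤ ε) ∧
      ‖Q - U * diagonal (fun j => (h j : ℂ)) * star U‖ ≤ ε := by
  obtain ⟨n, Q, hQ, hQ1, hQ2⟩ := exists_strictUpper_norm_sub_le hε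
  set B : Matrix (Fin n) (Fin n) ℂ := (1 / 2 : ℂ) • (Q + Qᴴ) with hBdef
  have hB : B.IsHermitian := by
    rw [IsHermitian, hBdef, conjTranspose_smul, conjTranspose_add, conjTranspose_conjTranspose,
      add_comm]
    simp
  have hBn : ‖B‖ = 1 := by
    rw [hBdef, norm_smul, hQ2]
    norm_num
  have hQB : ‖Q - B‖ ≤ ε := by
    have : Q - B = (1 / 2 : ℂ) • (Q - Qᴴ) := by
      rw [hBdef, smul_add, smul_sub, ← sub_eq_zero]
      have h1 : Q = (1 / 2 : ℂ) • Q + (1 / 2 : ℂ) • Q := by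
        rw [← add_smul]; norm_num
      nth_rewrite 1 [h1]
      abel
    rw [this, norm_smul]
    norm_num
    linarith
  have hev := hB.norm_eq_norm_eigenvalues
  rw [hBn] at hev
  have hev1 : ∀ i, |hB.eigenvalues i| ≤ 1 := fun i => by
    rw [hev]
    exact norm_le_pi_norm hB.eigenvalues i
  obtain ⟨i0, hi0⟩ : ∃ i, |hB.eigenvalues i| = 1 := by
    by_contra! hcon
    have : ‖hB.eigenvalues‖ < 1 := (pi_norm_lt_iff one_pos).2 fun i => (hev1 i).lt_of_ne (hcon i)
    exact absurd hev this.ne'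
  obtain ⟨M, hM⟩ := exists_nat_gt (1 / ε)
  have hM0 : (0 : ℝ) < M := lt_trans (by positivity) hM
  have hM1 : 1 / (M : ℝ) ≤ ε := by
    rw [div_le_iff₀ hM0]
    rw [div_lt_iff₀ hε] at hM
    linarith
  -- the multiples of `Q` to be summed up: a grid of mesh at most `ε` in `[-1, 1]`
  set t : Fin (2 * M + 1) → ℝ := fun k => (k : ℝ) / M - 1 with ht
  have ht1 : ∀ k, |t k| ≤ 1 := fun k => by
    have hk : (k : ℝ) ≤ 2 * M := by
      have := k.2
      exact_mod_cast (by omega : (k : ℕ) ≤ 2 * M)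
    rw [ht, abs_le]
    constructor
    · have : 0 ≤ (k : ℝ) / M := by positivity
      simp only
      linarith
    · have : (k : ℝ) / M ≤ 2 := by rwa [div_le_iff₀ hM0]
      simp only
      linarith
  have htd : ∀ s : ℝ, |s| ≤ 1 → ∃ k, |t k - s| ≤ ε := fun s hs => by
    obtain ⟨hs1, hs2⟩ := abs_le.1 hs
    have h0 : 0 ≤ (s + 1) * M := mul_nonneg (by linarith) hM0.le
    have hfl := Nat.floor_le h0
    have hfl' := Nat.lt_floor_add_one ((s + 1) * M)
    have hlt : ⌊(s + 1) * M⌋₊ < 2 * M + 1 := by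
      have : ((⌊(s + 1) * M⌋₊ : ℕ) : ℝ) ≤ (2 * M : ℕ) := by
        push_cast
        nlinarith
      have := Nat.cast_le.1 this
      omega
    refine ⟨⟨_, hlt⟩, ?_⟩
    have h3 : t ⟨_, hlt⟩ - s = ((⌊(s + 1) * M⌋₊ : ℝ) - (s + 1) * M) / M := by
      simp only [ht]
      field_simp
      ring
    rw [h3, abs_div, abs_of_pos hM0]
    refine le_trans ?_ hM1
    gcongr
    rw [abs_le]
    constructor <;> linarith
  set e : Fin (2 * M + 1) × Fin n ≃ Fin ((2 * M + 1) * n) := finProdFinEquiv with he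
  set Φ := amplificationHom (2 * M + 1) n with hΦ
  set D : Matrix (Fin ((2 * M + 1) * n)) (Fin ((2 * M + 1) * n)) ℂ :=
    diagonal fun x => (t (e.symm x).1 : ℂ) with hD
  have hDΦ : ∀ (C : Matrix (Fin n) (Fin n) ℂ) a b a' b', (D * Φ C) (e (a, b)) (e (a', b')) =
      if a = a' then t a * C b b' else 0 := fun C a b a' b' => by
    rw [hD, diagonal_mul, hΦ, he, amplificationHom_apply, Equiv.symm_apply_apply]
    simp
  set U0 : Matrix (Fin n) (Fin n) ℂ := hB.eigenvectorUnitary.1 with hU0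
  have hspec : B = U0 * diagonal (fun i => (hB.eigenvalues i : ℂ)) * star U0 := by
    conv_lhs => rw [hB.spectral_theorem, Unitary.conjStarAlgAut_apply]
    rfl
  have hΦ1 : Φ 1 = 1 := by
    ext x y
    obtain ⟨⟨a, b⟩, rfl⟩ := e.surjective x
    obtain ⟨⟨a', b'⟩, rfl⟩ := e.surjective y
    rw [hΦ, he, amplificationHom_apply, one_apply, one_apply]
    simp only [EmbeddingLike.apply_eq_iff_eq, Prod.mk.injEq]
    by_cases h1 : a = a' <;> by_cases h2 : b = b' <;> simp [h1, h2]
  have hcomm : ∀ C, Φ C * D = D * Φ C := fun C => by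
    ext x y
    obtain ⟨⟨a, b⟩, rfl⟩ := e.surjective x
    obtain ⟨⟨a', b'⟩, rfl⟩ := e.surjective y
    rw [hDΦ, hD, mul_diagonal, hΦ, he, amplificationHom_apply, Equiv.symm_apply_apply]
    split_ifs with h
    · rw [h, mul_comm]
    · rw [zero_mul]
  refine ⟨(2 * M + 1) * n, D * Φ Q, Φ U0, fun x => t (e.symm x).1 * hB.eigenvalues (e.symm x).2,
    ?_, ?_, ?_, ?_, ?_⟩
  · intro x y hxy
    obtain ⟨⟨a, b⟩, rfl⟩ := e.surjective x
    obtain ⟨⟨a', b'⟩, rfl⟩ := e.surjective y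
    rw [hDΦ]
    split_ifs with h
    · subst h
      rw [hQ, mul_zero]
      rw [Fin.le_def] at hxy ⊢
      simp only [he, finProdFinEquiv_apply_val] at hxy
      omega
    · rfl
  · have h1 := Unitary.coe_star_mul_self hB.eigenvectorUnitary
    have h2 := Unitary.coe_mul_star_self hB.eigenvectorUnitary
    rw [Unitary.mem_iff, ← map_star, ← map_mul, ← map_mul]
    exact ⟨by rw [← hΦ1]; exact congrArg Φ h1, by rw [← hΦ1]; exact congrArg Φ h2⟩
  · intro x
    rw [abs_mul]
    exact mul_le_one₀ (ht1 _) (abs_nonneg _) (hev1 _)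
  · intro s hs
    set η := hB.eigenvalues i0 with hη
    -- `η` is `1` or `-1`, so the multiple close to `s * η` has an eigenvalue close to `s`
    have hη2 : η * η = 1 := by rw [← abs_mul_abs_self, hi0, one_mul]
    obtain ⟨k, hk⟩ := htd (s * η) (by rw [abs_mul, hi0, mul_one]; exact hs)
    refine ⟨e (k, i0), ?_⟩
    have : t k * η - s = (t k - s * η) * η := by
      linear_combination s * hη2
    show |t (e.symm (e (k, i0))).1 * hB.eigenvalues (e.symm (e (k, i0))).2 - s| ≤ ε
    rw [Equiv.symm_apply_apply]
    show |t k * η - s| ≤ ε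
    rwa [this, abs_mul, hi0, mul_one]
  · have h1 : Φ U0 * diagonal (fun x => ((t (e.symm x).1 * hB.eigenvalues (e.symm x).2 : ℝ) : ℂ)) *
        star (Φ U0) = D * Φ B := by
      have h2 : diagonal (fun x => ((t (e.symm x).1 * hB.eigenvalues (e.symm x).2 : ℝ) : ℂ)) =
          D * Φ (diagonal fun i => (hB.eigenvalues i : ℂ)) := by
        ext x y
        obtain ⟨⟨a, b⟩, rfl⟩ := e.surjective x
        obtain ⟨⟨a', b'⟩, rfl⟩ := e.surjective y
        rw [hDΦ, diagonal_apply, diagonal_apply, Equiv.symm_apply_apply]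
        simp only [EmbeddingLike.apply_eq_iff_eq, Prod.mk.injEq]
        by_cases h3 : a = a' <;> by_cases h4 : b = b' <;> simp [h3, h4]
      rw [h2, ← mul_assoc, hcomm, ← map_star, mul_assoc, mul_assoc, ← map_mul, ← map_mul, ← mul_assoc U0,
        ← hspec]
    rw [h1, ← mul_sub, ← map_sub]
    refine (norm_mul_le _ _).trans ?_
    have hDn : ‖D‖ ≤ 1 := by
      rw [hD, l2_opNorm_diagonal, pi_norm_le_iff_of_nonneg zero_le_one]
      intro x
      rw [Complex.norm_real]
      exact ht1 _
    calc ‖D‖ * ‖Φ (Q - B)‖ ≤ 1 * ‖Q - B‖ :=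
          mul_le_mul hDn (NonUnitalStarAlgHom.norm_apply_le Φ _) (norm_nonneg _) zero_le_one
      _ ≤ ε := by rwa [one_mul]

end BlockSum

open Matrix Polynomial in
/-- An upper triangular matrix with distinct diagonal entries is similar to its diagonal. -/
theorem exists_mul_eq_mul_diagonal {n : ℕ} {T : Matrix (Fin n) (Fin n) ℂ}
    (hT : ∀ i j, j < i → T i j = 0) (hinj : Function.Injective fun i => T i i) :
    ∃ P P' : Matrix (Fin n) (Fin n) ℂ, P * P' = 1 ∧ P' * P = 1 ∧
      T * P = P * diagonal fun i => T i i := by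
  have hchar : T.charpoly = ∏ i, (X - C (T i i)) :=
    charpoly_of_isUpperTriangular T fun i j h => hT i j h
  have hev : ∀ i, Module.End.HasEigenvalue (toLin' T) (T i i) := fun i => by
    rw [Module.End.hasEigenvalue_iff_mem_spectrum, spectrum_toLin',
      mem_spectrum_iff_isRoot_charpoly, hchar, IsRoot, eval_prod]
    exact Finset.prod_eq_zero (Finset.mem_univ i) (by simp)
  choose v hv using fun i => (hev i).exists_hasEigenvector
  have hli := Module.End.eigenvectors_linearIndependent' (toLin' T) _ hinj v hv
  set P : Matrix (Fin n) (Fin n) ℂ := Matrix.of fun i j => v j i with hP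
  have hu : IsUnit P := linearIndependent_cols_iff_isUnit.1 hli
  obtain ⟨u, hu⟩ := hu
  refine ⟨P, ((u⁻¹ : (Matrix (Fin n) (Fin n) ℂ)ˣ) : Matrix (Fin n) (Fin n) ℂ), ?_, ?_, ?_⟩
  · rw [← hu, Units.mul_inv]
  · rw [← hu, Units.inv_mul]
  · ext i j
    have h1 := congrFun ((hv j).apply_eq_smul) i
    rw [toLin'_apply] at h1
    rw [mul_diagonal]
    simp only [hP, of_apply]
    rw [mul_comm]
    exact h1

/-! ### Spreading an accumulation point of the spectrum over a segment -/

section Segment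

open scoped Matrix.Norms.L2Operator

variable {A : Type*} [CStarAlgebra A]

open Matrix in
/-- Equivalent orthogonal projections are the diagonal of a system of matrix units. -/
theorem HasInterchangeableProjections.exists_matrixHom (hA : HasInterchangeableProjections A)
    {n : ℕ} {p : Fin n → A} (hp : ∀ i, IsStarProjection (p i)) (hp0 : ∀ i, p i ≠ 0)
    (ho : ∀ i j, i ≠ j → p i * p j = 0) :
    ∃ φ : Matrix (Fin n) (Fin n) ℂ →⋆ₙₐ[ℂ] A, ∀ c : Fin n → ℂ,
      φ (diagonal c) = ∑ i, c i • p i := by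
  rcases isEmpty_or_nonempty (Fin n) with hn | ⟨⟨i0⟩⟩
  · exact ⟨0, fun c => by simp⟩
  choose v hv hv' using fun i => hA.mvNEquiv (p i0) (p i) (hp i0) (hp i) (hp0 i0) (hp0 i)
  have hvp : ∀ i, v i * p i0 = v i := fun i => (hp i0).eq_of_mvN (hv i)
  have hpv : ∀ i, p i * v i = v i := fun i => (hp i).mul_eq_of_mvN (hv' i)
  have hvp' : ∀ i, star (v i) * p i = star (v i) := fun i => by
    have := congrArg star (hpv i)
    rwa [star_mul, (hp i).isSelfAdjoint.star_eq] at this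
  have hvv : ∀ i j, star (v i) * v j = if i = j then p i0 else 0 := fun i j => by
    split_ifs with h
    · rw [h, hv]
    · rw [← hvp' i, ← hpv j, mul_assoc, ← mul_assoc (p i), ho i j h, zero_mul, mul_zero]
  have he : ∀ i j k l, v i * star (v j) * (v k * star (v l)) =
      if j = k then v i * star (v l) else 0 := fun i j k l => by
    rw [mul_assoc, ← mul_assoc (star (v j)), hvv]
    split_ifs
    · rw [← mul_assoc, hvp]
    · rw [zero_mul, mul_zero]
  refine ⟨{ toFun := fun B => ∑ i, ∑ j, B i j • (v i * star (v j))
            map_smul' := ?_, map_zero' := ?_, map_add' := ?_, map_mul' := ?_, map_star' := ?_ },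
    fun c => ?_⟩
  · intro r B
    simp [Finset.smul_sum, mul_smul]
  · simp
  · intro B C
    simp [add_smul, Finset.sum_add_distrib]
  · intro B C
    show ∑ i, ∑ l, (B * C) i l • (v i * star (v l)) =
      (∑ i, ∑ j, B i j • (v i * star (v j))) * ∑ k, ∑ l, C k l • (v k * star (v l))
    rw [Finset.sum_mul]
    refine Finset.sum_congr rfl fun i _ => ?_
    have h1 : ∀ l, (B * C) i l • (v i * star (v l)) =
        ∑ j, (B i j * C j l) • (v i * star (v l)) := fun l => by
      rw [mul_apply, Finset.sum_smul]
    simp only [h1]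
    have h2 : ∀ j, (B i j • (v i * star (v j))) * ∑ k, ∑ l, C k l • (v k * star (v l)) =
        ∑ l, (B i j * C j l) • (v i * star (v l)) := fun j => by
      rw [Finset.mul_sum, Finset.sum_eq_single_of_mem j (Finset.mem_univ j), Finset.mul_sum]
      · refine Finset.sum_congr rfl fun l _ => ?_
        rw [smul_mul_smul_comm, he, if_pos rfl]
      · intro k _ hkj
        rw [Finset.mul_sum]
        refine Finset.sum_eq_zero fun l _ => ?_
        rw [smul_mul_smul_comm, he, if_neg hkj.symm, smul_zero]
    rw [Finset.sum_comm, Finset.sum_mul]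
    exact Finset.sum_congr rfl fun j _ => (h2 j).symm
  · intro B
    simp only [star_sum, star_smul, star_mul, star_star]
    rw [Finset.sum_comm]
    rfl
  · show ∑ i, ∑ j, diagonal c i j • (v i * star (v j)) = _
    refine Finset.sum_congr rfl fun i _ => ?_
    rw [Finset.sum_eq_single i, diagonal_apply_eq, hv']
    · intro j _ hji
      rw [diagonal_apply_ne _ hji.symm, zero_smul]
    · simp

/-- `B ↦ φ B + (1 - φ 1)` acts by multiplication on the corner of `φ` and fixes `r`, which lives on
the complementary corner. -/
theorem matrixHom_conj {n : ℕ} (φ : Matrix (Fin n) (Fin n) ℂ →⋆ₙₐ[ℂ] A) {r : A}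
    (h1 : r * φ 1 = 0) (h2 : φ 1 * r = 0) (B X C : Matrix (Fin n) (Fin n) ℂ) :
    (φ B + (1 - φ 1)) * (r + φ X) * (φ C + (1 - φ 1)) = r + φ (B * X * C) := by
  have e1 : ∀ X, φ 1 * φ X = φ X := fun X => by rw [← map_mul, one_mul]
  have e2 : ∀ X, φ X * φ 1 = φ X := fun X => by rw [← map_mul, mul_one]
  have e3 : φ B * r = 0 := by rw [← e2 B, mul_assoc, h2, mul_zero]
  have e4 : r * φ C = 0 := by rw [← e1 C, ← mul_assoc, h1, zero_mul]
  have s1 : (φ B + (1 - φ 1)) * (r + φ X) = r + φ (B * X) := by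
    rw [mul_add, add_mul, add_mul, sub_mul, sub_mul, one_mul, one_mul, e3, h2, e1, map_mul]
    abel
  rw [s1, mul_add, add_mul, add_mul, mul_sub, mul_sub, mul_one, mul_one, e4, h1, e2, ← map_mul]
  abel

theorem matrixHom_add_mul {n : ℕ} (φ : Matrix (Fin n) (Fin n) ℂ →⋆ₙₐ[ℂ] A)
    {B C : Matrix (Fin n) (Fin n) ℂ} (h : B * C = 1) :
    (φ B + (1 - φ 1)) * (φ C + (1 - φ 1)) = 1 := by
  have e0 : φ 1 * φ 1 = φ 1 := by rw [← map_mul, one_mul]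
  have := matrixHom_conj φ (r := 1 - φ 1) (by rw [sub_mul, one_mul, e0, sub_self])
    (by rw [mul_sub, mul_one, e0, sub_self]) B 1 C
  rw [sub_add_cancel, mul_one, mul_one, h, sub_add_cancel] at this
  exact this

open Filter Topology Matrix in
/-- The basic move: if `μ` is not isolated in `K`, the eigenvalues of `a` near `μ` can be perturbed,
after a similarity, into any segment centred at `μ`. Distinct eigenvalues near `μ` are
similar to `μ` plus a strictly upper triangular matrix, and such matrices approximate hermitian
ones with spectrum dense in a segment. -/
theorem mem_closure_similarityOrbit_of_segment (hA : HasInterchangeableProjections A) {K : Set ℂ}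
    (hK : IsCompact K) {a b : A} {μ c : ℂ} (ha : IsDiagonalLimit K a)
    (hμ : IsNonIsolatedPoint K μ)
    (hb : IsDiagonalLimit (K ∪ {z | ∃ t : ℝ, |t| ≤ 1 ∧ z = μ + c * t}) b) :
    b ∈ closure (similarityOrbit a) := by
  rw [Metric.mem_closure_iff]
  intro ε hε
  set η : ℝ := ε / (6 + 2 * ‖c‖) with hηdef
  have hη : 0 < η := by positivity
  obtain ⟨n, Q, U, h, hQ, hU, hh1, hhd, hQU⟩ := exists_strictUpper_near_hermitian hη
  -- distinct points of `K` near `μ`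
  obtain ⟨ν, hνinj, hν⟩ : ∃ ν : Fin n → ℂ, Function.Injective ν ∧
      ∀ j, ν j ∈ K ∧ ‖ν j - μ‖ ≤ η := by
    have hinf : (Metric.ball μ η ∩ K).Infinite :=
      Set.Infinite.of_accPt (hμ.2.nhds_inter (Metric.ball_mem_nhds μ hη))
    refine ⟨fun j => hinf.natEmbedding _ j, fun i j hij => ?_, fun j => ?_⟩
    · exact Fin.ext ((hinf.natEmbedding _).injective (Subtype.ext hij))
    · have := (hinf.natEmbedding _ j).2
      exact ⟨this.2, by rw [← dist_eq_norm]; exact (Metric.mem_ball.1 this.1).le⟩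
  set T : Matrix (Fin n) (Fin n) ℂ := diagonal ν + c • Q with hT
  have hTd : ∀ i, T i i = ν i := fun i => by
    simp [hT, hQ i i le_rfl]
  obtain ⟨P, P', hPP', hP'P, hTP⟩ := exists_mul_eq_mul_diagonal (T := T)
    (fun i j hij => by simp [hT, hQ i j hij.le, diagonal_apply_ne _ hij.ne'])
    (by simpa only [hTd] using hνinj)
  simp only [hTd] at hTP
  set C₁ : ℝ := ‖P‖ + ‖(1 : A)‖ + ‖(1 : Matrix (Fin n) (Fin n) ℂ)‖ + 1 with hC₁
  set C₂ : ℝ := ‖P'‖ + ‖(1 : A)‖ + ‖(1 : Matrix (Fin n) (Fin n) ℂ)‖ + 1 with hC₂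
  have hC₁1 : 1 ≤ C₁ := by
    have : 0 ≤ ‖P‖ + ‖(1 : A)‖ + ‖(1 : Matrix (Fin n) (Fin n) ℂ)‖ := by positivity
    linarith
  have hC₂1 : 1 ≤ C₂ := by
    have : 0 ≤ ‖P'‖ + ‖(1 : A)‖ + ‖(1 : Matrix (Fin n) (Fin n) ℂ)‖ := by positivity
    linarith
  have hCpos : 0 < C₁ * C₂ := by positivity
  -- the norms of the similarities are controlled before the approximation of `a` is chosen
  set δ : ℝ := η / (C₁ * C₂) with hδdef
  have hδ : 0 < δ := by positivity
  have hδη : δ ≤ η := div_le_self hη.le (one_le_mul_of_one_le_of_one_le hC₁1 hC₂1)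
  obtain ⟨t, htK, htfin, ht⟩ := hK.finite_cover_balls hδ
  have : Fintype t := htfin.fintype
  have hnet : ∀ z ∈ K, ∃ y : t, ‖(y : ℂ) - z‖ ≤ δ := fun z hz => by
    obtain ⟨y, hy, hzy⟩ := Set.mem_iUnion₂.1 (ht hz)
    refine ⟨⟨y, hy⟩, ?_⟩
    rw [Metric.mem_ball, dist_comm, dist_eq_norm] at hzy
    exact hzy.le
  obtain ⟨d, ⟨p, hp, rfl⟩, had⟩ := ha.exists_isDiagonal hA
    (lam := Sum.elim (fun y : t => (y : ℂ)) ν) hδ.le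
    (by
      rintro (y | j)
      · exact ⟨y, htK y.2, by simpa using hδ.le⟩
      · exact ⟨ν j, (hν j).1, by simpa using hδ.le⟩)
    (fun z hz => by
      obtain ⟨y, hy⟩ := hnet z hz
      exact ⟨Sum.inl y, hy⟩) hδ
  obtain ⟨φ, hφ⟩ := hA.exists_matrixHom (p := fun j => p (Sum.inr j)) (fun j => hp.proj _)
    (fun j => hp.ne_zero _) fun i j hij => hp.orthogonal _ _ fun h => hij (Sum.inr_injective h)
  set r : A := ∑ y : t, (y : ℂ) • p (Sum.inl y) with hr
  have hφ1 : φ 1 = ∑ j, p (Sum.inr j) := by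
    rw [← diagonal_one, hφ]
    simp
  have hr1 : r * φ 1 = 0 := by
    rw [hφ1, hr, Finset.sum_mul]
    refine Finset.sum_eq_zero fun y _ => ?_
    rw [Finset.mul_sum]
    exact Finset.sum_eq_zero fun j _ => by
      rw [smul_mul_assoc, hp.orthogonal _ _ Sum.inl_ne_inr, smul_zero]
  have hr2 : φ 1 * r = 0 := by
    rw [hφ1, hr, Finset.mul_sum]
    refine Finset.sum_eq_zero fun y _ => ?_
    rw [Finset.sum_mul]
    exact Finset.sum_eq_zero fun j _ => by
      rw [mul_smul_comm, hp.orthogonal _ _ Sum.inr_ne_inl, smul_zero]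
  have hdiag : ∀ w : Fin n → ℂ,
      ∑ i, Sum.elim (fun y : t => (y : ℂ)) w i • p i = r + φ (diagonal w) := fun w => by
    rw [hφ, hr, Fintype.sum_sum_type]
    rfl
  rw [hdiag] at had
  set V : Aˣ := ⟨φ P + (1 - φ 1), φ P' + (1 - φ 1), matrixHom_add_mul φ hPP',
    matrixHom_add_mul φ hP'P⟩ with hV
  have hVn : ‖(V : A)‖ ≤ C₁ := by
    show ‖φ P + (1 - φ 1)‖ ≤ C₁
    have h1 := NonUnitalStarAlgHom.norm_apply_le φ P
    have h2 := NonUnitalStarAlgHom.norm_apply_le φ 1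
    linarith [norm_add_le (φ P) (1 - φ 1), norm_sub_le (1 : A) (φ 1)]
  have hVn' : ‖((V⁻¹ : Aˣ) : A)‖ ≤ C₂ := by
    show ‖φ P' + (1 - φ 1)‖ ≤ C₂
    have h1 := NonUnitalStarAlgHom.norm_apply_le φ P'
    have h2 := NonUnitalStarAlgHom.norm_apply_le φ 1
    linarith [norm_add_le (φ P') (1 - φ 1), norm_sub_le (1 : A) (φ 1)]
  have hVd : (V : A) * (r + φ (diagonal ν)) * ((V⁻¹ : Aˣ) : A) = r + φ T := by
    show (φ P + (1 - φ 1)) * (r + φ (diagonal ν)) * (φ P' + (1 - φ 1)) = r + φ T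
    rw [matrixHom_conj φ hr1 hr2, ← hTP, mul_assoc, hPP', mul_one]
  have hstar : star (φ U + (1 - φ 1)) = φ (star U) + (1 - φ 1) := by
    rw [star_add, star_sub, star_one, map_star, ← map_star φ 1, star_one]
  set W : unitary A := ⟨φ U + (1 - φ 1), by
    rw [Unitary.mem_iff, hstar]
    exact ⟨matrixHom_add_mul φ (Unitary.star_mul_self_of_mem hU),
      matrixHom_add_mul φ (Unitary.mul_star_self_of_mem hU)⟩⟩ with hW
  set w : Fin n → ℂ := fun j => μ + c * h j with hw
  have hX : IsDiagonal (Sum.elim (fun y : t => (y : ℂ)) w) (r + φ (diagonal w)) :=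
    ⟨p, hp, (hdiag w).symm⟩
  have hWX : (W : A) * (r + φ (diagonal w)) * star (W : A) =
      r + φ (μ • 1 + c • (U * diagonal (fun j => (h j : ℂ)) * star U)) := by
    show (φ U + (1 - φ 1)) * (r + φ (diagonal w)) * star (φ U + (1 - φ 1)) = _
    rw [hstar, matrixHom_conj φ hr1 hr2]
    have : diagonal w = μ • (1 : Matrix (Fin n) (Fin n) ℂ) + c • diagonal fun j => (h j : ℂ) := by
      rw [← diagonal_one, ← diagonal_smul, ← diagonal_smul, diagonal_add]
      congr 1
      ext j
      simp [hw]
    rw [this, mul_add, add_mul, mul_smul_comm, mul_smul_comm, mul_one, smul_mul_assoc,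
      smul_mul_assoc, Unitary.mul_star_self_of_mem hU]
  have hclose : ‖(V : A) * (r + φ (diagonal ν)) * ((V⁻¹ : Aˣ) : A) -
      (W : A) * (r + φ (diagonal w)) * star (W : A)‖ ≤ η + ‖c‖ * η := by
    rw [hVd, hWX, add_sub_add_left_eq_sub, ← map_sub]
    refine (NonUnitalStarAlgHom.norm_apply_le φ _).trans ?_
    have h1 : T - (μ • 1 + c • (U * diagonal (fun j => (h j : ℂ)) * star U)) =
        diagonal (fun j => ν j - μ) + c • (Q - U * diagonal (fun j => (h j : ℂ)) * star U) := by
      have : diagonal (fun j => ν j - μ) = diagonal ν - μ • (1 : Matrix (Fin n) (Fin n) ℂ) := by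
        rw [← diagonal_one, ← diagonal_smul, diagonal_sub]
        congr 1
        ext j
        simp
      rw [this, hT, smul_sub]
      abel
    rw [h1]
    refine (norm_add_le _ _).trans (add_le_add ?_ ?_)
    · rw [l2_opNorm_diagonal, pi_norm_le_iff_of_nonneg hη.le]
      exact fun j => (hν j).2
    · rw [norm_smul]
      exact mul_le_mul_of_nonneg_left hQU (norm_nonneg _)
  obtain ⟨d', hd', hbd'⟩ := hb.exists_isDiagonal hA
    (lam := Sum.elim (fun y : t => (y : ℂ)) w) (C := η * (1 + ‖c‖)) (by positivity)
    (by
      rintro (y | j)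
      · exact ⟨y, Or.inl (htK y.2), by simp; positivity⟩
      · exact ⟨w j, Or.inr ⟨h j, hh1 j, rfl⟩, by simp; positivity⟩)
    (by
      rintro z (hz | ⟨s, hs, rfl⟩)
      · obtain ⟨y, hy⟩ := hnet z hz
        refine ⟨Sum.inl y, hy.trans (hδη.trans ?_)⟩
        nlinarith [norm_nonneg c]
      · obtain ⟨j, hj⟩ := hhd s hs
        refine ⟨Sum.inr j, ?_⟩
        have h1 : w j - (μ + c * s) = c * ((h j - s : ℝ) : ℂ) := by
          simp only [hw]
          push_cast
          ring
        rw [Sum.elim_inr, h1, norm_mul, Complex.norm_real, Real.norm_eq_abs]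
        nlinarith [norm_nonneg c]) hη
  obtain ⟨u, hu⟩ := (hX.unitary_conj W).exists_unitary_conj hA hd'
  refine ⟨(u : A) * ((V : A) * a * ((V⁻¹ : Aˣ) : A)) * star (u : A),
    ⟨Unitary.toUnits u * V, ?_⟩, ?_⟩
  · rw [_root_.mul_inv_rev, Units.val_mul, Units.val_mul]
    simp only [Unitary.val_toUnits_apply, Unitary.val_inv_toUnits_apply, mul_assoc]
    rfl
  · have hsplit : b - (u : A) * ((V : A) * a * ((V⁻¹ : Aˣ) : A)) * star (u : A) =
        (b - d') - (u : A) * ((V : A) * (a - (r + φ (diagonal ν))) * ((V⁻¹ : Aˣ) : A) +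
          ((V : A) * (r + φ (diagonal ν)) * ((V⁻¹ : Aˣ) : A) -
            (W : A) * (r + φ (diagonal w)) * star (W : A))) * star (u : A) := by
      rw [← hu]
      simp only [mul_add, mul_sub, add_mul, sub_mul]
      abel
    rw [dist_eq_norm, hsplit]
    refine lt_of_le_of_lt (norm_sub_le _ _) ?_
    rw [norm_unitary_conj]
    have h1 : ‖(V : A) * (a - (r + φ (diagonal ν))) * ((V⁻¹ : Aˣ) : A)‖ ≤ 2 * η := by
      calc _ ≤ ‖(V : A)‖ * ‖a - (r + φ (diagonal ν))‖ * ‖((V⁻¹ : Aˣ) : A)‖ :=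
            (norm_mul_le _ _).trans (mul_le_mul_of_nonneg_right (norm_mul_le _ _) (norm_nonneg _))
        _ ≤ C₁ * (δ + δ) * C₂ := by gcongr
        _ = 2 * η := by
            rw [hδdef]
            field_simp
            ring
    have h2 := norm_add_le ((V : A) * (a - (r + φ (diagonal ν))) * ((V⁻¹ : Aˣ) : A))
      ((V : A) * (r + φ (diagonal ν)) * ((V⁻¹ : Aˣ) : A) -
            (W : A) * (r + φ (diagonal w)) * star (W : A))
    have h3 : η * (6 + 2 * ‖c‖) = ε := by
      rw [hηdef]
      field_simp
    nlinarith [norm_nonneg c]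

end Segment

/-! ### Chains of segments -/

section Reachability

section Chains

open Filter Topology

theorem IsNonIsolatedPoint.mono {S S' : Set ℂ} {z : ℂ} (h : IsNonIsolatedPoint S z)
    (hS : S ⊆ S') : IsNonIsolatedPoint S' z :=
  ⟨hS h.1, h.2.mono (principal_mono.2 hS)⟩

theorem isNonIsolatedPoint_segment {z w : ℂ} (h : w ≠ z) :
    IsNonIsolatedPoint {y | ∃ t : ℝ, |t| ≤ 1 ∧ y = z + (w - z) * t} w := by
  refine ⟨⟨1, by simp, by simp⟩, accPt_iff_nhds.2 fun U hU => ?_⟩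
  have hc : Continuous fun t : ℝ => z + (w - z) * t := by fun_prop
  have h1 : ∀ᶠ t : ℝ in 𝓝 1, z + (w - z) * t ∈ U := hc.continuousAt (by simpa using hU)
  obtain ⟨t, htU, ht⟩ := ((h1.filter_mono nhdsWithin_le_nhds).and
    (Ioo_mem_nhdsLT (zero_lt_one (α := ℝ)))).exists
  refine ⟨_, ⟨htU, t, abs_le.2 ⟨by linarith [ht.1], ht.2.le⟩, rfl⟩, fun h2 => ?_⟩
  have h3 : (w - z) * ((t : ℂ) - 1) = 0 := by linear_combination h2
  rcases mul_eq_zero.1 h3 with h4 | h4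
  · exact h (sub_eq_zero.1 h4)
  · exact ht.2.ne (by exact_mod_cast sub_eq_zero.1 h4)

/-- A property of sets that is stable under attaching short segments at non-isolated points can be
propagated along a connected set. -/
theorem exists_superset_of_isPreconnected {R : Set ℂ → Prop} {C : Set ℂ} {ε : ℝ} (hε : 0 < ε)
    (hstep : ∀ K z w, R K → IsNonIsolatedPoint K z → z ∈ C → ‖w - z‖ ≤ ε →
      R (K ∪ {y | ∃ t : ℝ, |t| ≤ 1 ∧ y = z + (w - z) * t}))
    (hC : IsPreconnected C) {K : Set ℂ} (hK : R K) {z w : ℂ} (hz : z ∈ C)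
    (hzK : IsNonIsolatedPoint K z) (hw : w ∈ C) :
    ∃ K', K ⊆ K' ∧ R K' ∧ IsNonIsolatedPoint K' w := by
  set G : Set ℂ := {w | ∃ K', K ⊆ K' ∧ R K' ∧ IsNonIsolatedPoint K' w} with hG
  have hnear : ∀ x ∈ G, x ∈ C → ∀ y, ‖y - x‖ ≤ ε → y ∈ G := by
    rintro x ⟨K', hKK', hR, hx⟩ hxC y hy
    rcases eq_or_ne y x with rfl | hne
    · exact ⟨K', hKK', hR, hx⟩
    · exact ⟨_, hKK'.trans Set.subset_union_left, hstep K' x y hR hx hxC hy,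
        (isNonIsolatedPoint_segment hne).mono Set.subset_union_right⟩
  by_contra hwG
  obtain ⟨y, hyC, hy1, hy2⟩ := hC (⋃ x ∈ C ∩ G, Metric.ball x ε) (⋃ x ∈ C \ G, Metric.ball x ε)
    (isOpen_biUnion fun _ _ => Metric.isOpen_ball) (isOpen_biUnion fun _ _ => Metric.isOpen_ball)
    (fun x hx => by
      by_cases hxG : x ∈ G
      · exact Or.inl (Set.mem_biUnion ⟨hx, hxG⟩ (Metric.mem_ball_self hε))
      · exact Or.inr (Set.mem_biUnion ⟨hx, hxG⟩ (Metric.mem_ball_self hε)))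
    ⟨z, hz, Set.mem_biUnion ⟨hz, K, subset_rfl, hK, hzK⟩ (Metric.mem_ball_self hε)⟩
    ⟨w, hw, Set.mem_biUnion ⟨hw, hwG⟩ (Metric.mem_ball_self hε)⟩
  obtain ⟨g, hg, hyg⟩ := Set.mem_iUnion₂.1 hy1
  obtain ⟨g', hg', hyg'⟩ := Set.mem_iUnion₂.1 hy2
  rw [Metric.mem_ball, dist_eq_norm] at hyg hyg'
  have hyG : y ∈ G := hnear g hg.2 hg.1 y hyg.le
  exact hg'.2 (hnear y hyG hyC g' (by rw [norm_sub_rev]; exact hyg'.le))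

end Chains

variable {A : Type*} [CStarAlgebra A]

theorem similarityOrbit_subset_closure {M a : A} (ha : a ∈ closure (similarityOrbit M)) :
    similarityOrbit a ⊆ closure (similarityOrbit M) := by
  rintro _ ⟨V, rfl⟩
  refine map_mem_closure (f := fun x : A => (V : A) * x * ((V⁻¹ : Aˣ) : A)) (by fun_prop) ha ?_
  rintro _ ⟨W, rfl⟩
  refine ⟨V * W, ?_⟩
  simp [mul_assoc]

theorem closure_similarityOrbit_trans {M a b : A} (ha : a ∈ closure (similarityOrbit M))
    (hb : b ∈ closure (similarityOrbit a)) : b ∈ closure (similarityOrbit M) :=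
  closure_minimal (similarityOrbit_subset_closure ha) isClosed_closure hb

theorem unitary_conj_mem_similarityOrbit (u : unitary A) (a : A) :
    (u : A) * a * star (u : A) ∈ similarityOrbit a :=
  ⟨Unitary.toUnits u, rfl⟩

open Filter Topology in
/-- Starting from `M`, the spectrum is enlarged segment by segment along the components of the
spectrum of `N`, until it is `ε`-dense there. -/
theorem mem_closure_similarityOrbit_of_spectrum [Nontrivial A]
    (hA : HasInterchangeableProjections A) {M N : A}
    (hM : IsDiagonalLimit (spectrum ℂ M) M) (hN : IsDiagonalLimit (spectrum ℂ N) N)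
    (h1 : spectrum ℂ M ⊆ spectrum ℂ N)
    (h2 : ∀ lam ∈ spectrum ℂ N,
      (connectedComponentIn (spectrum ℂ N) lam ∩ spectrum ℂ M).Nonempty)
    (h4 : ∀ lam : ℂ, IsNonIsolatedPoint (spectrum ℂ N) lam →
      ∃ μ ∈ connectedComponentIn (spectrum ℂ N) lam, IsNonIsolatedPoint (spectrum ℂ M) μ) :
    N ∈ closure (similarityOrbit M) := by
  rw [← closure_closure, Metric.mem_closure_iff]
  intro ε' hε'
  set ε : ℝ := ε' / 3 with hεdef
  have hε : 0 < ε := by positivity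
  -- the sets of eigenvalues reachable from `M` inside the `ε`-neighbourhood of the spectrum of `N`
  set R : Set ℂ → Prop := fun K => IsCompact K ∧ spectrum ℂ M ⊆ K ∧
    (∀ z ∈ K, ∃ w ∈ spectrum ℂ N, ‖z - w‖ ≤ ε) ∧
    ∃ a : A, IsDiagonalLimit K a ∧ a ∈ closure (similarityOrbit M) with hR
  have hR0 : R (spectrum ℂ M) := ⟨spectrum.isCompact M, subset_rfl,
    fun z hz => ⟨z, h1 hz, by simpa using hε.le⟩, M, hM, subset_closure ⟨1, by simp⟩⟩
  have hstep : ∀ K z w, R K → IsNonIsolatedPoint K z → z ∈ spectrum ℂ N → ‖w - z‖ ≤ ε →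
      R (K ∪ {y | ∃ t : ℝ, |t| ≤ 1 ∧ y = z + (w - z) * t}) := by
    rintro K z w ⟨hK, hMK, hKN, a, haK, haM⟩ hz hzN hwz
    have hseg : IsCompact {y | ∃ t : ℝ, |t| ≤ 1 ∧ y = z + (w - z) * t} := by
      have : {y | ∃ t : ℝ, |t| ≤ 1 ∧ y = z + (w - z) * t} =
          (fun t : ℝ => z + (w - z) * t) '' Set.Icc (-1) 1 := by
        ext y
        simp only [Set.mem_ofPred_eq, Set.mem_image, Set.mem_Icc, abs_le, eq_comm (a := y)]
      rw [this]
      exact isCompact_Icc.image (by fun_prop)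
    have hK' := hK.union hseg
    obtain ⟨b, hb⟩ := exists_isDiagonalLimit hA hK' ⟨z, Or.inl hz.1⟩
    refine ⟨hK', hMK.trans Set.subset_union_left, ?_, b, hb, closure_similarityOrbit_trans haM
      (mem_closure_similarityOrbit_of_segment hA hK haK hz hb)⟩
    rintro y (hy | ⟨t, ht, rfl⟩)
    · exact hKN y hy
    · refine ⟨z, hzN, ?_⟩
      rw [add_sub_cancel_left, norm_mul, Complex.norm_real, Real.norm_eq_abs]
      exact (mul_le_of_le_one_right (norm_nonneg _) ht).trans hwz
  have hpt : ∀ K lam, R K → lam ∈ spectrum ℂ N → ∃ K', K ⊆ K' ∧ R K' ∧ lam ∈ K' := by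
    intro K lam hK hlam
    set C := connectedComponentIn (spectrum ℂ N) lam with hC
    have hCpre : IsPreconnected C := isPreconnected_connectedComponentIn
    have hCN : C ⊆ spectrum ℂ N := connectedComponentIn_subset _ _
    have hlamC : lam ∈ C := mem_connectedComponentIn hlam
    by_cases hacc : IsNonIsolatedPoint (spectrum ℂ N) lam
    · obtain ⟨μ, hμC, hμ⟩ := h4 lam hacc
      obtain ⟨K', hKK', hRK', hlamK'⟩ := exists_superset_of_isPreconnected hε
        (fun K z w hK hz hzC => hstep K z w hK hz (hCN hzC)) hCpre hK hμC (hμ.mono hK.2.1) hlamC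
      exact ⟨K', hKK', hRK', hlamK'.1⟩
    · -- the component of an isolated point is a singleton, which then lies in `spectrum ℂ M`
      obtain ⟨y, hyC, hyM⟩ := h2 lam hlam
      have hy : y = lam := by
        by_contra hne
        have := hCpre.preperfect_of_nontrivial ⟨y, hyC, lam, hlamC, hne⟩ lam hlamC
        exact hacc ⟨hlam, this.mono (principal_mono.2 hCN)⟩
      exact ⟨K, subset_rfl, hK, hK.2.1 (hy ▸ hyM)⟩
  have hfin : ∀ F : Finset ℂ, (∀ lam ∈ F, lam ∈ spectrum ℂ N) →
      ∃ K, R K ∧ ∀ lam ∈ F, lam ∈ K := by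
    classical
    intro F
    induction F using Finset.induction_on with
    | empty => exact fun _ => ⟨_, hR0, by simp⟩
    | insert x F _ ih =>
      intro hF
      obtain ⟨K, hK, hFK⟩ := ih fun lam hlam => hF lam (Finset.mem_insert_of_mem hlam)
      obtain ⟨K', hKK', hK', hx⟩ := hpt K x hK (hF x (Finset.mem_insert_self x F))
      refine ⟨K', hK', fun lam hlam => ?_⟩
      rcases Finset.mem_insert.1 hlam with rfl | hlam
      · exact hx
      · exact hKK' (hFK lam hlam)
  obtain ⟨t, htN, htfin, ht⟩ := (spectrum.isCompact (𝕜 := ℂ) N).finite_cover_balls hε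
  obtain ⟨K, ⟨hK, hMK, hKN, a, haK, haM⟩, htK⟩ := hfin htfin.toFinset
    fun lam hlam => htN (htfin.mem_toFinset.1 hlam)
  obtain ⟨u, hu⟩ := haK.exists_unitary_conj_near hA hN hε.le
    (fun w hw => by
      obtain ⟨y, hy, hwy⟩ := Set.mem_iUnion₂.1 (ht hw)
      rw [Metric.mem_ball, dist_eq_norm] at hwy
      exact ⟨y, htK y (htfin.mem_toFinset.2 hy), hwy.le⟩)
    (fun z hz => by
      obtain ⟨w, hw, hzw⟩ := hKN z hz
      exact ⟨w, hw, by rwa [norm_sub_rev]⟩) hε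
  refine ⟨_, similarityOrbit_subset_closure haM (unitary_conj_mem_similarityOrbit u a), ?_⟩
  rw [dist_comm, dist_eq_norm]
  linarith

end Reachability

/-! ### Closed similarity orbits of normal elements -/

theorem theorem4p3 {A : Type*} [CStarAlgebra A]
    (hFN : WeakFN A)
    (hinf : ∀ p : A, IsStarProjection p → p ≠ 0 → IsProperlyInfinite p)
    (hequiv : ∀ p q : A, IsStarProjection p → IsStarProjection q → p ≠ 0 → q ≠ 0 → MvNEquiv p q)
    (N M : A) (hN : IsStarNormal N) (hM : IsStarNormal M)
    (hM0 : ResolventInIdentityComponent M) :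
    N ∈ closure (similarityOrbit M) ↔
      (spectrum ℂ M ⊆ spectrum ℂ N ∧
        (∀ lam ∈ spectrum ℂ N,
          (connectedComponentIn (spectrum ℂ N) lam ∩ spectrum ℂ M).Nonempty) ∧
        ResolventInIdentityComponent N ∧
        (∀ lam : ℂ, IsNonIsolatedPoint (spectrum ℂ N) lam →
          ∃ μ ∈ connectedComponentIn (spectrum ℂ N) lam,
            IsNonIsolatedPoint (spectrum ℂ M) μ)) := by
  constructor
  · intro h
    exact ⟨spectrum_subset_of_mem_closure h,
      fun lam hlam => connectedComponentIn_inter_spectrum_nonempty hM hN h hlam,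
      resolventInIdentityComponent_of_mem_closure h hM0,
      fun lam hlam => exists_isNonIsolatedPoint_of_mem_closure hM hN h hlam⟩
  · rintro ⟨h1, h2, h3, h4⟩
    rcases subsingleton_or_nontrivial A with hs | hs
    · exact subset_closure ⟨1, Subsingleton.elim _ _⟩
    · exact mem_closure_similarityOrbit_of_spectrum
        (hasInterchangeableProjections_of_isProperlyInfinite hinf hequiv)
        (isDiagonalLimit_spectrum hFN hM hM0) (isDiagonalLimit_spectrum hFN hN h3) h1 h2 h4
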